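/- Let $m_1,m_2\ge1$ be integers, $l=m_1+m_2$, and let $e_{i,j}$ denote the $l\times l$ matrix units. Put $$W(z,s)=\bigl(z-\tfrac12\bigr)e_{1,m_1}-s\,e_{1,l}+s\sum_{i=2}^{l}e_{i,i-1}.$$ For $1\le a\le m_1$ let $q_a=\frac{a}{m_1}$ and $K_a=\sum_{j=1}^{a}e_{j,m_1-a+j}$; for $m_1+1\le a\le l-1$ let $q_a=\frac{l-a}{m_2}$ and $K_a=-\sum_{j=1}^{l-a}e_{a+j,m_1+j}$. Then for every $a=1,\dots,l-1$ the topological difference equation $$M(z-1,s)\,W(z,s)=W(z,s)\,M(z,s)$$ has a unique formal solution $M_a(z,s)\in z^{1-q_a}\,\mathrm{Mat}\bigl(l\times l,\mathbb{C}(s)((z^{-1}))\bigr)$ of the form $M_a(z,s)=z^{1-q_a}\bigl(K_a+O(z^{-1})\bigr)$, where $O(z^{-1})$ stands for an element of $z^{-1}\mathrm{Mat}(l\times l,\mathbb{C}(s)[[z^{-1}]])$ and $(z-1)^{\beta}$ is expanded as $\sum_{k\ge0}(-1)^k\binom{\beta}{k}z^{\beta-k}$; and this solution satisfies $$M_a(z,s)\in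 z^{1-q_a}\,\mathrm{Mat}\bigl(l\times l,\mathbb{Q}[s][[z^{-1}]]\bigr).$$ That is, its coefficients are polynomials in $s$ with rational coefficients. -/

import Mathlib

noncomputable section

namespace TDE

/-- `Ser K` is the ring of Hahn series in `z⁻¹` over `K` with rational exponents: the coefficient
of a series at `r : ℚ` is its coefficient at `z ^ (-r)`. It contains `z ^ α * K((z⁻¹))` for every
rational `α`. -/
abbrev Ser (K : Type) [Field K] : Type := HahnSeries ℚ K

/-- The monomial `z ^ α`, for a rational exponent `α`. -/
def zpow (K : Type) [Field K] (α : ℚ) : Ser K := HahnSeries.single (-α) 1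

/-- The embedding of `K⟦z⁻¹⟧`, power series in the variable `X = z⁻¹`. -/
def ofPow (K : Type) [Field K] : PowerSeries K →+* Ser K := HahnSeries.ofPowerSeries ℚ K

/-- The embedding of `K((z⁻¹))`, Laurent series in the variable `z⁻¹`. -/
def ofLaurent (K : Type) [Field K] : LaurentSeries K →+* Ser K :=
  HahnSeries.embDomainRingHom (Int.castAddHom ℚ) Int.cast_injective fun _ _ => Int.cast_le

theorem shift_support_finite {K : Type} [Field K] (f : Ser K) (r : ℚ) :
    {k : ℕ | f.coeff (r - k) ≠ 0}.Finite := by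
  by_contra h
  have hinf : {k : ℕ | f.coeff (r - k) ≠ 0}.Infinite := h
  have hpwo := f.isWF_support
  rw [Set.isWF_iff_no_descending_seq] at hpwo
  refine hpwo (fun n => r - (Nat.nth (fun k => f.coeff (r - k) ≠ 0) n : ℕ)) ?_ ?_
  · intro a b hab
    have h2 : ((Nat.nth (fun k => f.coeff (r - k) ≠ 0) a : ℕ) : ℚ) <
        (Nat.nth (fun k => f.coeff (r - k) ≠ 0) b : ℕ) := by
      exact_mod_cast Nat.nth_strictMono hinf hab
    simp only
    linarith
  · intro n
    exact Nat.nth_mem_of_infinite hinf n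

/-- The formal shift `f(z) ↦ f(z - 1)`: it acts coefficientwise, and sends `z ^ (-r)` to
`(z - 1) ^ (-r) = ∑ k, (-1) ^ k * (-r choose k) * z ^ (-r - k)`. The sum below, which collects all
contributions to `z ^ (-r)`, has only finitely many non-zero terms by `shift_support_finite`. -/
def shift {K : Type} [Field K] (f : Ser K) : Ser K where
  coeff r := ∑ᶠ k : ℕ,
    (-1 : K) ^ k * ((Ring.choose (-(r - k)) k : ℚ) : K) * f.coeff (r - k)
  isPWO_support' := by
    have hN : (Set.range (Nat.cast : ℕ → ℚ)).IsPWO := by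
      rw [← Set.image_univ]
      exact (Set.IsWF.of_wellFoundedLT _).isPWO.image_of_monotone Nat.mono_cast
    refine (f.isPWO_support.add hN).mono ?_
    intro r hr
    obtain ⟨k, hk⟩ : ∃ k : ℕ,
        (-1 : K) ^ k * ((Ring.choose (-(r - k)) k : ℚ) : K) * f.coeff (r - k) ≠ 0 := by
      by_contra! h
      exact hr (finsum_eq_zero_of_forall_eq_zero h)
    exact Set.mem_add.mpr ⟨r - k, right_ne_zero_of_mul hk, k, ⟨k, rfl⟩, by ring⟩

/-- The `n × n` matrix unit `e_{i,j}`, with rows and columns numbered `1, …, n`. -/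
def eUnit {R : Type} [Zero R] [One R] (n i j : ℕ) : Matrix (Fin n) (Fin n) R :=
  Matrix.of fun p q => if p.val + 1 = i ∧ q.val + 1 = j then 1 else 0

/-- The base field `ℂ(s)`. -/
abbrev Cs : Type := RatFunc ℂ

/-- The indeterminate `s`, as a constant series. -/
def sVar : Ser Cs := HahnSeries.C RatFunc.X

/-- `W(z,s) = (z - 1/2) e_{1,m₁} - s e_{1,l} + s ∑_{i=2}^{l} e_{i,i-1}`, with `l = m₁ + m₂`. -/
def W (m₁ m₂ : ℕ) : Matrix (Fin (m₁ + m₂)) (Fin (m₁ + m₂)) (Ser Cs) :=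
  (zpow Cs 1 - HahnSeries.C (1 / 2)) • eUnit (m₁ + m₂) 1 m₁
    - sVar • eUnit (m₁ + m₂) 1 (m₁ + m₂)
    + sVar • ∑ i ∈ Finset.Icc 2 (m₁ + m₂), eUnit (m₁ + m₂) i (i - 1)

/-- The number `q_a`. -/
def q (m₁ m₂ a : ℕ) : ℚ :=
  if a ≤ m₁ then (a : ℚ) / m₁ else ((m₁ + m₂ : ℚ) - a) / m₂

/-- The constant matrix `K_a` (for `1 ≤ a ≤ l - 1`). -/
def KMat (m₁ m₂ a : ℕ) : Matrix (Fin (m₁ + m₂)) (Fin (m₁ + m₂)) (Ser Cs) :=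
  if a ≤ m₁ then
    ∑ j ∈ Finset.Icc 1 a, eUnit (m₁ + m₂) j (m₁ - a + j)
  else
    -∑ j ∈ Finset.Icc 1 (m₁ + m₂ - a), eUnit (m₁ + m₂) (a + j) (m₁ + j)

/-- `M(z,s)` is a formal solution in `z ^ (1 - q_a) Mat(l × l, ℂ(s)((z⁻¹)))` of the topological
difference equation of `(m₁,m₂)`-type, with leading term `K_a`. -/
structure IsSolution (m₁ m₂ a : ℕ)
    (M : Matrix (Fin (m₁ + m₂)) (Fin (m₁ + m₂)) (Ser Cs)) : Prop where
  /-- `M ∈ z ^ (1 - q_a) Mat(l × l, ℂ(s)((z⁻¹)))`. -/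
  mem : ∃ N : Matrix (Fin (m₁ + m₂)) (Fin (m₁ + m₂)) (LaurentSeries Cs),
    M = zpow Cs (1 - q m₁ m₂ a) • N.map (ofLaurent Cs)
  /-- `M(z - 1, s) W(z, s) = W(z, s) M(z, s)`. -/
  tde : M.map shift * W m₁ m₂ = W m₁ m₂ * M
  /-- `M(z, s) = z ^ (1 - q_a) (K_a + O(z⁻¹))`. -/
  leading : ∃ R : Matrix (Fin (m₁ + m₂)) (Fin (m₁ + m₂)) (PowerSeries Cs),
    M = zpow Cs (1 - q m₁ m₂ a) • (KMat m₁ m₂ a + zpow Cs (-1) • R.map (ofPow Cs))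

/-- The inclusion `ℚ[s] → ℂ(s)`. -/
def polyIncl : Polynomial ℚ →+* Cs :=
  (algebraMap (Polynomial ℂ) Cs).comp (Polynomial.mapRingHom (algebraMap ℚ ℂ))

/-- The inclusion of `ℚ[s]⟦z⁻¹⟧` in the ring of series. -/
def ofRatPow : PowerSeries (Polynomial ℚ) →+* Ser Cs :=
  (ofPow Cs).comp (PowerSeries.map polyIncl)

end TDE

end

/-! Number rows and columns from 0 and put l = m₁ + m₂. The rows of the equation below the first
propagate entries along diagonals, up to multiples of first-column entries, so `M` is determined by
its first column s·y, with y = (y_0, …, y_{l-1}). `solEntry` is the resulting closed form and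
`eq_zero_of_tdeEntry_succ` shows that there is no other choice.

The first row then becomes l scalar equations (`tdeEntry_solEntry_eq_zero_iff`) (z - 1/2 + c) y_n(z
+ t) - (z + 1/2) y_n(z) = ±s (y_{σ(n)}(z + m₁) - y_{σ(n)}(z - m₂)). On a leading term z^(-r) the
left side acts as multiplication by the indicial factor c - 1 - t r, while the right side drops the
order. The coefficients therefore satisfy a recursion whose only divisions are by indicial factors.
These are rational and the couplings are ±s, so everything stays in ℚ[s].

The factor of index n vanishes only at n / m₁ if n < m₁, and only at (l - n) / m₂ if n ≥ m₁. Thus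
q_a is the root of index a. All roots are at most 1 and q_a > 0, so none is met at q_a + k with k ≥
1. Existence follows by starting from the unit vector of index a at order z^(-q_a); the matrix has
leading term K_a, after adding the identity (itself a solution) when a = m₁.

For uniqueness, the difference of two solutions has order at most z^(-q_a). Vanishing of its
coefficients at z^(1 - q_a) kills the leading coefficients of all y_n with n ≠ 0. The index 0 has
root 0 < q_a, so the recursion forces y = 0. -/

noncomputable section

namespace TDE

/-! ### Integer shifts of formal series and their action on leading coefficients -/

section Shift

variable {K : Type} [Field K]

/-- The shift `f(z) ↦ f(z + t)` by an integer `t`. -/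
def shiftBy (t : ℤ) (f : Ser K) : Ser K where
  coeff r := ∑ᶠ k : ℕ, (t : K) ^ k * ((Ring.choose (-(r - k)) k : ℚ) : K) * f.coeff (r - k)
  isPWO_support' := by
    have hN : (Set.range (Nat.cast : ℕ → ℚ)).IsPWO := by
      rw [← Set.image_univ]
      exact (Set.IsWF.of_wellFoundedLT _).isPWO.image_of_monotone Nat.mono_cast
    refine (f.isPWO_support.add hN).mono ?_
    intro r hr
    obtain ⟨k, hk⟩ : ∃ k : ℕ,
        (t : K) ^ k * ((Ring.choose (-(r - k)) k : ℚ) : K) * f.coeff (r - k) ≠ 0 := by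
      by_contra! h
      exact hr (finsum_eq_zero_of_forall_eq_zero h)
    exact Set.mem_add.mpr ⟨r - k, right_ne_zero_of_mul hk, k, ⟨k, rfl⟩, by ring⟩

theorem shift_eq_shiftBy (f : Ser K) : shift f = shiftBy (-1) f := by
  ext r
  simp [shift, shiftBy]

theorem exists_forall_coeff_sub_eq_zero (f : Ser K) (r : ℚ) :
    ∃ N : ℕ, ∀ k ≥ N, f.coeff (r - k) = 0 := by
  obtain ⟨N, hN⟩ := (shift_support_finite f r).bddAbove
  refine ⟨N + 1, fun k hk => ?_⟩
  by_contra h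
  have := hN (show k ∈ {k : ℕ | f.coeff (r - k) ≠ 0} from h)
  omega

theorem shiftBy_coeff_eq_sum (t : ℤ) (f : Ser K) (r : ℚ) (N : ℕ)
    (hN : ∀ k ≥ N, f.coeff (r - k) = 0) :
    (shiftBy t f).coeff r = ∑ k ∈ Finset.range N,
      (t : K) ^ k * ((Ring.choose (-(r - k)) k : ℚ) : K) * f.coeff (r - k) := by
  refine finsum_eq_sum_of_support_subset _ fun k hk => ?_
  by_contra h
  simp only [Finset.coe_range, Set.mem_Iio, not_lt] at h
  exact hk (by simp [hN k h])

theorem shiftBy_add (t : ℤ) (f g : Ser K) : shiftBy t (f + g) = shiftBy t f + shiftBy t g := by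
  ext r
  obtain ⟨N, hN⟩ := exists_forall_coeff_sub_eq_zero f r
  obtain ⟨N', hN'⟩ := exists_forall_coeff_sub_eq_zero g r
  have h₁ : ∀ k ≥ max N N', f.coeff (r - k) = 0 := fun k hk => hN k (le_of_max_le_left hk)
  have h₂ : ∀ k ≥ max N N', g.coeff (r - k) = 0 := fun k hk => hN' k (le_of_max_le_right hk)
  rw [HahnSeries.coeff_add, shiftBy_coeff_eq_sum t f r _ h₁, shiftBy_coeff_eq_sum t g r _ h₂,
    shiftBy_coeff_eq_sum t (f + g) r _ fun k hk => by simp [h₁ k hk, h₂ k hk],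
    ← Finset.sum_add_distrib]
  exact Finset.sum_congr rfl fun k _ => by rw [HahnSeries.coeff_add]; ring

theorem shiftBy_C_mul (t : ℤ) (c : K) (f : Ser K) :
    shiftBy t (HahnSeries.C c * f) = HahnSeries.C c * shiftBy t f := by
  ext r
  obtain ⟨N, hN⟩ := exists_forall_coeff_sub_eq_zero f r
  rw [HahnSeries.C_mul_eq_smul, HahnSeries.C_mul_eq_smul, HahnSeries.coeff_smul,
    shiftBy_coeff_eq_sum t f r _ hN,
    shiftBy_coeff_eq_sum t (c • f) r _ fun k hk => by simp [hN k hk], Finset.smul_sum]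
  exact Finset.sum_congr rfl fun k _ => by
    rw [HahnSeries.coeff_smul, smul_eq_mul, smul_eq_mul]; ring

theorem shiftBy_zero_right (t : ℤ) : shiftBy t (0 : Ser K) = 0 := by
  simpa using shiftBy_C_mul t 0 (0 : Ser K)

theorem shiftBy_neg (t : ℤ) (f : Ser K) : shiftBy t (-f) = -shiftBy t f := by
  simpa using shiftBy_C_mul t (-1) f

theorem shiftBy_sub (t : ℤ) (f g : Ser K) : shiftBy t (f - g) = shiftBy t f - shiftBy t g := by
  rw [sub_eq_add_neg, shiftBy_add, shiftBy_neg, sub_eq_add_neg]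

theorem shiftBy_zero (f : Ser K) : shiftBy 0 f = f := by
  ext r
  obtain ⟨N, hN⟩ := exists_forall_coeff_sub_eq_zero f r
  rw [shiftBy_coeff_eq_sum 0 f r (N + 1) fun k hk => hN k (by omega), Finset.sum_range_succ',
    Finset.sum_eq_zero fun k _ => by simp]
  simp

/-- This is the binomial theorem for (t + u)^n combined with the product formula for two successive
generalized binomial coefficients. It makes shifts invertible and lets them accumulate along
diagonals. -/
theorem shiftBy_shiftBy [CharZero K] (t u : ℤ) (f : Ser K) :
    shiftBy t (shiftBy u f) = shiftBy (t + u) f := by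
  ext r
  obtain ⟨N, hN⟩ := exists_forall_coeff_sub_eq_zero f r
  have hin (j : ℕ) : ∀ k ≥ N - j, f.coeff (r - j - k) = 0 := fun k hk => by
    have := hN (j + k) (by omega)
    rwa [Nat.cast_add, ← sub_sub] at this
  rw [shiftBy_coeff_eq_sum (t + u) f r N hN, shiftBy_coeff_eq_sum t (shiftBy u f) r N fun j hj => by
    rw [shiftBy_coeff_eq_sum u f _ _ (hin j), Nat.sub_eq_zero_of_le hj]; simp]
  have h₁ : ∀ j ∈ Finset.range N,
      (t : K) ^ j * ((Ring.choose (-(r - j)) j : ℚ) : K) * (shiftBy u f).coeff (r - j) =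
      ∑ k ∈ Finset.range (N - j), (fun j k : ℕ => (t : K) ^ j * (u : K) ^ k *
        ((Ring.choose (-(r - j)) j * Ring.choose (-(r - j - k)) k : ℚ) : K) *
        f.coeff (r - j - k)) j k := fun j _ => by
    rw [shiftBy_coeff_eq_sum u f _ _ (hin j), Finset.mul_sum]
    exact Finset.sum_congr rfl fun k _ => by push_cast; ring
  rw [Finset.sum_congr rfl h₁, ← Finset.sum_range_diag_flip]
  refine Finset.sum_congr rfl fun n _ => ?_
  rw [Int.cast_add, add_pow, Finset.sum_mul, Finset.sum_mul]
  refine Finset.sum_congr rfl fun j hj => ?_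
  have hjn : j ≤ n := by simpa [Nat.lt_succ_iff] using hj
  have h₂ : r - j - (n - j : ℕ) = r - n := by rw [Nat.cast_sub hjn]; ring
  have h₃ := Ring.choose_smul_choose (-(r - n) : ℚ) (Nat.sub_le n j)
  rw [Nat.sub_sub_self hjn, Nat.choose_symm hjn, nsmul_eq_mul,
    show -(r - n) - ((n - j : ℕ) : ℚ) = -(r - j) by rw [Nat.cast_sub hjn]; ring] at h₃
  simp only [h₂]
  rw [mul_comm (Ring.choose (-(r - j)) j), ← h₃]
  push_cast
  ring

theorem coeff_zpow_mul (α r : ℚ) (f : Ser K) : (zpow K α * f).coeff r = f.coeff (r + α) := by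
  rw [zpow, HahnSeries.coeff_single_mul, one_mul, sub_neg_eq_add]

/-- Coefficientwise this is Pascal's rule, with the k = 0 term split off. -/
theorem shiftBy_zpow_one_mul [CharZero K] (t : ℤ) (f : Ser K) :
    shiftBy t (zpow K 1 * f) = (zpow K 1 + (t : Ser K)) * shiftBy t f := by
  have hC : (t : Ser K) = HahnSeries.C (t : K) := (map_intCast HahnSeries.C t).symm
  ext r
  obtain ⟨N, hN⟩ := exists_forall_coeff_sub_eq_zero f (r + 1)
  have hN' : ∀ k ≥ N, f.coeff (r - k) = 0 := fun k hk => by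
    have := hN (k + 1) (by omega)
    rwa [show r + 1 - ((k + 1 : ℕ) : ℚ) = r - k by push_cast; ring] at this
  rw [add_mul, HahnSeries.coeff_add, coeff_zpow_mul, hC, HahnSeries.C_mul_eq_smul,
    HahnSeries.coeff_smul, shiftBy_coeff_eq_sum t f (r + 1) (N + 1) fun k hk => hN k (by omega),
    shiftBy_coeff_eq_sum t f r N hN', shiftBy_coeff_eq_sum t _ r (N + 1) fun k hk => by
      rw [coeff_zpow_mul, sub_add_eq_add_sub]; exact hN k (by omega)]
  rw [Finset.sum_range_succ', Finset.sum_range_succ' _ N, smul_eq_mul, Finset.mul_sum,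
    add_right_comm, ← Finset.sum_add_distrib]
  congr 1
  · refine Finset.sum_congr rfl fun k _ => ?_
    have h := Ring.choose_succ_succ (-(r - k) : ℚ) k
    have e₁ : r - ((k + 1 : ℕ) : ℚ) + 1 = r - k := by push_cast; ring
    have e₂ : r + 1 - ((k + 1 : ℕ) : ℚ) = r - k := by push_cast; ring
    have e₃ : -(r - ((k + 1 : ℕ) : ℚ)) = -(r - k) + 1 := by push_cast; ring
    rw [coeff_zpow_mul, e₁, e₂, e₃, h]
    push_cast
    ring
  · simp [coeff_zpow_mul]

/-- The series `z - 1/2`. -/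
def zHalf (K : Type) [Field K] : Ser K := zpow K 1 - HahnSeries.C (1 / 2)

theorem coeff_zHalf_mul (r : ℚ) (f : Ser K) :
    (zHalf K * f).coeff r = f.coeff (r + 1) - 1 / 2 * f.coeff r := by
  rw [zHalf, sub_mul, HahnSeries.coeff_sub, coeff_zpow_mul, HahnSeries.C_mul_eq_smul,
    HahnSeries.coeff_smul, smul_eq_mul]

theorem shiftBy_zHalf_mul [CharZero K] (t : ℤ) (f : Ser K) :
    shiftBy t (zHalf K * f) = (zHalf K + (t : Ser K)) * shiftBy t f := by
  rw [zHalf, sub_mul, shiftBy_sub, shiftBy_zpow_one_mul, shiftBy_C_mul]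
  ring

theorem shiftBy_zHalf_add_mul [CharZero K] (t c : ℤ) (f : Ser K) :
    shiftBy t ((zHalf K + (c : Ser K)) * f) = (zHalf K + (c + t : ℤ)) * shiftBy t f := by
  have hC : (c : Ser K) = HahnSeries.C (c : K) := (map_intCast HahnSeries.C c).symm
  rw [add_mul, shiftBy_add, shiftBy_zHalf_mul, hC, shiftBy_C_mul, ← hC]
  push_cast
  ring

theorem shiftBy_coeff_of_vanish (t : ℤ) {f : Ser K} {r : ℚ}
    (hf : ∀ r' < r, f.coeff r' = 0) : (shiftBy t f).coeff r = f.coeff r := by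
  rw [shiftBy_coeff_eq_sum t f r 1 fun k hk => hf _ ?_]
  · simp
  · have : (1 : ℚ) ≤ k := by exact_mod_cast hk
    linarith

theorem shiftBy_coeff_add_one_of_vanish (t : ℤ) {f : Ser K} {r : ℚ}
    (hf : ∀ r' < r, f.coeff r' = 0) :
    (shiftBy t f).coeff (r + 1) = f.coeff (r + 1) - t * ((r : ℚ) : K) * f.coeff r := by
  rw [shiftBy_coeff_eq_sum t f (r + 1) 2 fun k hk => hf _ ?_]
  · simp [Finset.sum_range_succ]
    ring
  · have : (2 : ℚ) ≤ k := by exact_mod_cast hk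
    linarith

/-- The operator `(z - 1/2 + c) f(z + t) - (z + 1/2) f(z)`. -/
def diffOp (c t : ℤ) (f : Ser K) : Ser K :=
  (zHalf K + (c : Ser K)) * shiftBy t f - (zHalf K + 1) * f

theorem coeff_intCast_mul (c : ℤ) (f : Ser K) (r : ℚ) :
    ((c : Ser K) * f).coeff r = c * f.coeff r := by
  rw [← map_intCast HahnSeries.C c, HahnSeries.C_mul_eq_smul, HahnSeries.coeff_smul, smul_eq_mul]

/-- The contributions of the next coefficient, at `r + 1`, cancel between the two products by z.
What remains is the first Taylor term of the shift and the constants: the indicial factor. -/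
theorem diffOp_coeff_of_vanish [CharZero K] (c t : ℤ) {f : Ser K} {r : ℚ} (hf : ∀ r' < r, f.coeff r' = 0) :
    (diffOp c t f).coeff r = ((c - 1 - t * r : ℚ) : K) * f.coeff r := by
  rw [diffOp, HahnSeries.coeff_sub, add_mul, add_mul, one_mul, HahnSeries.coeff_add,
    HahnSeries.coeff_add, coeff_zHalf_mul, coeff_zHalf_mul, coeff_intCast_mul,
    shiftBy_coeff_add_one_of_vanish t hf, shiftBy_coeff_of_vanish t hf]
  push_cast
  ring

theorem diffOp_sub (c t : ℤ) (f g : Ser K) : diffOp c t (f - g) = diffOp c t f - diffOp c t g := by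
  rw [diffOp, diffOp, diffOp, shiftBy_sub]
  ring

/-- The operator `f(z + t) - f(z + u)`. -/
def shiftDiff (t u : ℤ) (f : Ser K) : Ser K := shiftBy t f - shiftBy u f

/-- Both shifts preserve the leading coefficient. This loss of order in the coupling is what makes
the system triangular. -/
theorem shiftDiff_coeff_of_vanish (t u : ℤ) {f : Ser K} {r : ℚ} (hf : ∀ r' < r, f.coeff r' = 0) :
    (shiftDiff t u f).coeff r = 0 := by
  rw [shiftDiff, HahnSeries.coeff_sub, shiftBy_coeff_of_vanish t hf, shiftBy_coeff_of_vanish u hf,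
    sub_self]

theorem shiftDiff_sub (t u : ℤ) (f g : Ser K) :
    shiftDiff t u (f - g) = shiftDiff t u f - shiftDiff t u g := by
  rw [shiftDiff, shiftDiff, shiftDiff, shiftBy_sub, shiftBy_sub]
  ring

theorem shiftBy_one (t : ℤ) : shiftBy t (1 : Ser K) = 1 := by
  ext r
  obtain ⟨N, hN⟩ := exists_forall_coeff_sub_eq_zero (1 : Ser K) r
  rw [shiftBy_coeff_eq_sum t 1 r (N + 1) fun k hk => hN k (by omega), Finset.sum_range_succ',
    Finset.sum_eq_zero fun k _ => ?_]
  · simp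
  · rw [HahnSeries.coeff_one]
    split_ifs with h
    · rw [h, neg_zero, Ring.choose_zero_succ]
      simp
    · simp

end Shift

/-! ### Series with support in ρ + ℕ and coefficients in a prescribed subring -/

section Graded

variable {K : Type} [Field K]

/-- The series `∑ k, x k * z ^ (-ρ - k)`. -/
def serOf (ρ : ℚ) (x : ℕ → K) : Ser K := zpow K (-ρ) * ofPow K (PowerSeries.mk x)

theorem ofPow_coeff_natCast (F : PowerSeries K) (n : ℕ) :
    (ofPow K F).coeff n = PowerSeries.coeff n F :=
  HahnSeries.ofPowerSeries_apply_coeff F n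

theorem exists_of_ofPow_coeff_ne_zero (F : PowerSeries K) {r : ℚ} (h : (ofPow K F).coeff r ≠ 0) :
    ∃ n : ℕ, r = n := by
  by_contra h'
  refine h ?_
  rw [ofPow, HahnSeries.ofPowerSeries_apply]
  refine HahnSeries.embDomain_of_notMem_range fun ⟨n, hn⟩ => h' ⟨n, hn.symm⟩

theorem serOf_coeff (ρ : ℚ) (x : ℕ → K) (n : ℕ) : (serOf ρ x).coeff (ρ + n) = x n := by
  rw [serOf, coeff_zpow_mul, add_neg_cancel_comm, ofPow_coeff_natCast, PowerSeries.coeff_mk]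

variable [CharZero K]

/-- The series in `z ^ (-ρ) * P⟦z⁻¹⟧`, for a subring `P` of `K` containing the rationals. -/
def gradedSeries (P : Subalgebra ℚ K) (ρ : ℚ) : AddSubgroup (Ser K) where
  carrier := {f | ∀ r, f.coeff r ∈ P ∧ (f.coeff r ≠ 0 → ∃ n : ℕ, r = ρ + n)}
  zero_mem' := fun r => by simp
  add_mem' := fun {f g} hf hg r => by
    refine ⟨P.add_mem (hf r).1 (hg r).1, fun h => ?_⟩
    by_cases h' : f.coeff r = 0
    · refine (hg r).2 fun h'' => h ?_
      rw [HahnSeries.coeff_add, h', h'', add_zero]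
    · exact (hf r).2 h'
  neg_mem' := fun {f} hf r => by
    refine ⟨P.neg_mem (hf r).1, fun h => (hf r).2 fun h' => h ?_⟩
    rw [HahnSeries.coeff_neg, h', neg_zero]

variable {P : Subalgebra ℚ K} {ρ : ℚ}

theorem C_mul_mem_gradedSeries {c : K} (hc : c ∈ P) {f : Ser K} (hf : f ∈ gradedSeries P ρ) :
    HahnSeries.C c * f ∈ gradedSeries P ρ := fun r => by
  rw [HahnSeries.C_mul_eq_smul, HahnSeries.coeff_smul, smul_eq_mul]
  exact ⟨P.mul_mem hc (hf r).1, fun h => (hf r).2 (right_ne_zero_of_mul h)⟩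

theorem ratCast_mem (P : Subalgebra ℚ K) (c : ℚ) : (c : K) ∈ P := by
  have h := P.algebraMap_mem c
  rwa [eq_ratCast] at h

theorem intCast_mul_mem_gradedSeries (c : ℤ) {f : Ser K} (hf : f ∈ gradedSeries P ρ) :
    (c : Ser K) * f ∈ gradedSeries P ρ := by
  rw [← map_intCast HahnSeries.C c]
  exact C_mul_mem_gradedSeries (P.intCast_mem c) hf

theorem zpow_mul_mem_gradedSeries (α : ℚ) {f : Ser K} (hf : f ∈ gradedSeries P ρ) :
    zpow K α * f ∈ gradedSeries P (ρ - α) := fun r => by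
  rw [coeff_zpow_mul]
  refine ⟨(hf _).1, fun h => ?_⟩
  obtain ⟨n, hn⟩ := (hf _).2 h
  exact ⟨n, by linarith⟩

theorem gradedSeries_mono (n : ℕ) : gradedSeries P (ρ + n) ≤ gradedSeries P ρ := fun f hf r => by
  refine ⟨(hf r).1, fun h => ?_⟩
  obtain ⟨k, hk⟩ := (hf r).2 h
  exact ⟨n + k, by rw [hk]; push_cast; ring⟩

theorem gradedSeries_sub_one : gradedSeries P ρ ≤ gradedSeries P (ρ - 1) := by
  simpa using gradedSeries_mono (P := P) (ρ := ρ - 1) 1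

theorem zHalf_mul_mem_gradedSeries {f : Ser K} (hf : f ∈ gradedSeries P ρ) :
    zHalf K * f ∈ gradedSeries P (ρ - 1) := by
  rw [zHalf, sub_mul]
  refine AddSubgroup.sub_mem _ (zpow_mul_mem_gradedSeries 1 hf)
    (gradedSeries_sub_one (C_mul_mem_gradedSeries ?_ hf))
  have h := ratCast_mem P (1 / 2)
  push_cast at h
  exact h

theorem shiftBy_mem_gradedSeries (t : ℤ) {f : Ser K} (hf : f ∈ gradedSeries P ρ) :
    shiftBy t f ∈ gradedSeries P ρ := fun r => by
  obtain ⟨N, hN⟩ := exists_forall_coeff_sub_eq_zero f r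
  rw [shiftBy_coeff_eq_sum t f r N hN]
  refine ⟨P.sum_mem fun k _ => P.mul_mem (P.mul_mem (P.pow_mem (P.intCast_mem t) _)
    (ratCast_mem P _)) (hf _).1, fun h => ?_⟩
  obtain ⟨k, _, hk⟩ := Finset.exists_ne_zero_of_sum_ne_zero h
  obtain ⟨n, hn⟩ := (hf _).2 (right_ne_zero_of_mul hk)
  exact ⟨n + k, by push_cast; linarith⟩

theorem shiftDiff_mem_gradedSeries (t u : ℤ) {f : Ser K} (hf : f ∈ gradedSeries P ρ) :
    shiftDiff t u f ∈ gradedSeries P ρ :=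
  AddSubgroup.sub_mem _ (shiftBy_mem_gradedSeries t hf) (shiftBy_mem_gradedSeries u hf)

theorem zHalf_add_mul_mem_gradedSeries (c : ℤ) {f : Ser K} (hf : f ∈ gradedSeries P ρ) :
    (zHalf K + (c : Ser K)) * f ∈ gradedSeries P (ρ - 1) := by
  rw [add_mul]
  exact AddSubgroup.add_mem _ (zHalf_mul_mem_gradedSeries hf)
    (gradedSeries_sub_one (intCast_mul_mem_gradedSeries c hf))

theorem diffOp_mem_gradedSeries_sub_one (c t : ℤ) {f : Ser K} (hf : f ∈ gradedSeries P ρ) :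
    diffOp c t f ∈ gradedSeries P (ρ - 1) := by
  refine AddSubgroup.sub_mem _ (zHalf_add_mul_mem_gradedSeries c (shiftBy_mem_gradedSeries t hf)) ?_
  simpa using zHalf_add_mul_mem_gradedSeries 1 hf

theorem coeff_eq_zero_of_lt {f : Ser K} (hf : f ∈ gradedSeries P ρ) {r : ℚ} (hr : r < ρ) :
    f.coeff r = 0 := by
  by_contra h
  obtain ⟨n, hn⟩ := (hf r).2 h
  have : (0 : ℚ) ≤ n := n.cast_nonneg
  linarith

theorem coeff_eq_zero_of_forall_lt {f : Ser K} (hf : f ∈ gradedSeries P ρ) {k : ℕ}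
    (h : ∀ j < k, f.coeff (ρ + j) = 0) {r : ℚ} (hr : r < ρ + k) : f.coeff r = 0 := by
  by_contra h'
  obtain ⟨n, rfl⟩ := (hf r).2 h'
  exact h' (h n (by exact_mod_cast (add_lt_add_iff_left ρ).1 hr))

theorem eq_zero_of_forall_coeff {f : Ser K} (hf : f ∈ gradedSeries P ρ)
    (h : ∀ k : ℕ, f.coeff (ρ + k) = 0) : f = 0 := by
  ext r
  by_contra h'
  obtain ⟨n, rfl⟩ := (hf r).2 h'
  exact h' (h n)

theorem ofPow_mem_gradedSeries {F : PowerSeries K} (hF : ∀ n, PowerSeries.coeff n F ∈ P) :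
    ofPow K F ∈ gradedSeries P 0 := fun r => by
  by_cases h : (ofPow K F).coeff r = 0
  · exact ⟨by rw [h]; exact P.zero_mem, fun h' => absurd h h'⟩
  · obtain ⟨n, rfl⟩ := exists_of_ofPow_coeff_ne_zero F h
    rw [ofPow_coeff_natCast]
    exact ⟨hF n, fun _ => ⟨n, by ring⟩⟩

theorem serOf_mem_gradedSeries {x : ℕ → K} (hx : ∀ n, x n ∈ P) : serOf ρ x ∈ gradedSeries P ρ := by
  have h := zpow_mul_mem_gradedSeries (-ρ) (ofPow_mem_gradedSeries (P := P)
    (F := PowerSeries.mk x) fun n => by rw [PowerSeries.coeff_mk]; exact hx n)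
  rwa [zero_sub, neg_neg] at h

theorem eq_serOf {f : Ser K} (hf : f ∈ gradedSeries P ρ) : f = serOf ρ fun k => f.coeff (ρ + k) := by
  rw [← sub_eq_zero]
  refine eq_zero_of_forall_coeff (AddSubgroup.sub_mem _ hf
    (serOf_mem_gradedSeries fun n => (hf _).1)) fun k => ?_
  rw [HahnSeries.coeff_sub, serOf_coeff, sub_self]

end Graded

/-! ### Coefficient recursion for triangular difference systems -/

section System

variable {K : Type} [Field K] [CharZero K] {ι : Type}

/-- The earlier terms are passed as a full sequence padded by zeros, so that the step may build a
series from them and read off a coefficient. -/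
theorem exists_fixed_recursion {X : Type} [Zero X] (step : (ℕ → X) → ℕ → X) :
    ∃ x : ℕ → X, ∀ k, x k = step (fun n => if n < k then x n else 0) k := by
  let x : ℕ → X := fun k => Nat.strongRec (motive := fun _ => X)
    (fun k ih => step (fun n => if h : n < k then ih n h else 0) k) k
  refine ⟨x, fun k => ?_⟩
  simp only [x]
  rw [Nat.strongRec]
  simp only [dite_eq_ite]

/-- Existence of formal solutions of a triangular first order system of difference equations. -/
theorem exists_system_solution (P : Subalgebra ℚ K) (ρ : ℚ) (c t : ι → ℤ) (v w : ℤ)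
    (e : ι → K) (he : ∀ i, e i ∈ P) (σ : ι → ι) (x₀ : ι → K) (hx₀ : ∀ i, x₀ i ∈ P) :
    ∃ y : ι → Ser K, (∀ i, y i ∈ gradedSeries P ρ) ∧ (∀ i, (y i).coeff ρ = x₀ i) ∧
      ∀ i, ((c i - 1 - t i * ρ : ℚ) : K) * x₀ i = 0 →
        (∀ k : ℕ, (c i - 1 - t i * (ρ + (k + 1 : ℕ)) : ℚ) ≠ 0) →
        diffOp (c i) (t i) (y i) = HahnSeries.C (e i) * shiftDiff v w (y (σ i)) := by
  let y (x : ℕ → ι → K) (i : ι) : Ser K := serOf ρ fun n => x n i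
  let F (x : ℕ → ι → K) (i : ι) : Ser K :=
    diffOp (c i) (t i) (y x i) - HahnSeries.C (e i) * shiftDiff v w (y x (σ i))
  -- The new coefficient is the residual of the truncated series at order `ρ + k`, divided by minus
  -- the indicial factor.
  obtain ⟨x, hx⟩ := exists_fixed_recursion (X := ι → K) fun x k i =>
    if k = 0 then x₀ i
    else -(((c i - 1 - t i * (ρ + k))⁻¹ : ℚ) : K) * (F x i).coeff (ρ + k)
  have hFmem (x : ℕ → ι → K) (hx : ∀ n i, x n i ∈ P) (i : ι) : F x i ∈ gradedSeries P (ρ - 1) := by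
    refine AddSubgroup.sub_mem _ (diffOp_mem_gradedSeries_sub_one _ _
      (serOf_mem_gradedSeries fun n => hx n i)) (gradedSeries_sub_one (C_mul_mem_gradedSeries (he i)
      (shiftDiff_mem_gradedSeries _ _ (serOf_mem_gradedSeries fun n => hx n _))))
  have hxP (k : ℕ) : ∀ i, x k i ∈ P := by
    induction k using Nat.strong_induction_on with
    | _ k ih =>
      intro i
      rw [hx k]
      split_ifs with h
      · exact hx₀ i
      · refine P.mul_mem (P.neg_mem (ratCast_mem P _)) (hFmem _ (fun n i => ?_) i _).1
        split_ifs with h'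
        · exact ih n h' i
        · exact P.zero_mem
  have hymem (i : ι) : y x i ∈ gradedSeries P ρ := serOf_mem_gradedSeries fun n => hxP n i
  have hx0 (i : ι) : x 0 i = x₀ i := by
    rw [hx 0]
    exact if_pos rfl
  have hy0 (i : ι) : (y x i).coeff ρ = x₀ i := by
    have := serOf_coeff ρ (fun n => x n i) 0
    rwa [Nat.cast_zero, add_zero, hx0] at this
  refine ⟨y x, hymem, hy0, fun i h₀ hne => ?_⟩
  rw [← sub_eq_zero]
  change F x i = 0
  have hlow (r : ℚ) (hr : r < ρ) (j : ι) : (y x j).coeff r = 0 :=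
    coeff_eq_zero_of_lt (hymem j) hr
  have hF0 : (F x i).coeff ρ = 0 := by
    rw [HahnSeries.coeff_sub, diffOp_coeff_of_vanish _ _ fun r hr => hlow r hr i,
      HahnSeries.C_mul_eq_smul, HahnSeries.coeff_smul,
      shiftDiff_coeff_of_vanish _ _ fun r hr => hlow r hr _, hy0, h₀, smul_zero, sub_zero]
  have hFlow : (F x i).coeff (ρ - 1) = 0 := by
    have hlow' (j : ι) : ∀ r < ρ - 1, (y x j).coeff r = 0 := fun r hr => hlow r (by linarith) j
    rw [HahnSeries.coeff_sub, diffOp_coeff_of_vanish _ _ (hlow' i),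
      HahnSeries.C_mul_eq_smul, HahnSeries.coeff_smul,
      shiftDiff_coeff_of_vanish _ _ (hlow' _), hlow _ (by linarith), mul_zero, smul_zero, sub_zero]
  refine eq_zero_of_forall_coeff (hFmem x hxP i) fun n => ?_
  match n with
  | 0 => simpa using hFlow
  | 1 => simpa using hF0
  | k + 2 =>
    rw [show ρ - 1 + ((k + 2 : ℕ) : ℚ) = ρ + (k + 1 : ℕ) by push_cast; ring]
    -- Passing from the truncation to the full sequence changes the residual at this order only by
    -- the indicial factor times `x (k + 1) i`; the coupling contributes nothing. The recursion
    -- makes this change cancel the truncated residual.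
    set x' : ℕ → ι → K := fun n => if n < k + 1 then x n else 0 with hx'
    have hx'P (n : ℕ) (i : ι) : x' n i ∈ P := by
      simp only [hx']
      split_ifs
      · exact hxP n i
      · exact P.zero_mem
    have hy'mem (i : ι) : y x' i ∈ gradedSeries P ρ := serOf_mem_gradedSeries fun n => hx'P n i
    have hdiff (j : ι) (n : ℕ) (hn : n < k + 1) : (y x j - y x' j).coeff (ρ + n) = 0 := by
      rw [HahnSeries.coeff_sub, serOf_coeff, serOf_coeff]
      simp only [hx', if_pos hn, sub_self]
    have hvan (j : ι) : ∀ r < ρ + (k + 1 : ℕ), (y x j - y x' j).coeff r = 0 := fun r hr =>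
      coeff_eq_zero_of_forall_lt (AddSubgroup.sub_mem _ (hymem j) (hy'mem j)) (hdiff j) hr
    have hsub : F x i - F x' i = diffOp (c i) (t i) (y x i - y x' i) -
        HahnSeries.C (e i) * shiftDiff v w (y x (σ i) - y x' (σ i)) := by
      rw [diffOp_sub, shiftDiff_sub]
      ring
    have hco : (F x i).coeff (ρ + (k + 1 : ℕ)) - (F x' i).coeff (ρ + (k + 1 : ℕ)) = _ :=
      (HahnSeries.coeff_sub (x := F x i) (y := F x' i)).symm.trans
        ((congrArg (fun f : Ser K => f.coeff (ρ + (k + 1 : ℕ))) hsub).trans HahnSeries.coeff_sub)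
    rw [diffOp_coeff_of_vanish _ _ (hvan i), HahnSeries.C_mul_eq_smul, HahnSeries.coeff_smul,
      shiftDiff_coeff_of_vanish _ _ (hvan _), smul_zero, sub_zero,
      HahnSeries.coeff_sub (x := y x i), serOf_coeff, serOf_coeff] at hco
    have hxk := congrFun (hx (k + 1)) i
    rw [if_neg (Nat.succ_ne_zero k)] at hxk
    have hne' : ((c i - 1 - t i * (ρ + (k + 1 : ℕ)) : ℚ) : K) ≠ 0 := Rat.cast_ne_zero.2 (hne k)
    rw [hxk, show x' (k + 1) i = 0 by simp [hx'], sub_zero, Rat.cast_inv, ← mul_assoc, mul_neg,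
      mul_inv_cancel₀ hne', neg_one_mul] at hco
    exact (sub_eq_neg_self).1 hco

/-- Uniqueness of formal solutions of a triangular first order system of difference equations. -/
theorem system_solution_eq_zero (P : Subalgebra ℚ K) (ρ : ℚ) (c t : ι → ℤ) (v w : ℤ)
    (e : ι → K) (σ : ι → ι) (y : ι → Ser K) (hy : ∀ i, y i ∈ gradedSeries P ρ)
    (hne : ∀ i (k : ℕ), (c i - 1 - t i * (ρ + k) : ℚ) ≠ 0 ∨ (y i).coeff (ρ + k) = 0)
    (heq : ∀ i, diffOp (c i) (t i) (y i) = HahnSeries.C (e i) * shiftDiff v w (y (σ i))) :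
    ∀ i, y i = 0 := by
  have key (k : ℕ) : ∀ i, (y i).coeff (ρ + k) = 0 := by
    induction k using Nat.strong_induction_on with
    | _ k ih =>
      intro i
      have hvan (j : ι) : ∀ r < ρ + k, (y j).coeff r = 0 := fun r hr =>
        coeff_eq_zero_of_forall_lt (hy j) (fun n hn => ih n hn j) hr
      have h : (diffOp (c i) (t i) (y i)).coeff (ρ + k) = _ :=
        congrArg (fun f : Ser K => f.coeff (ρ + k)) (heq i)
      rw [diffOp_coeff_of_vanish _ _ (hvan i), HahnSeries.C_mul_eq_smul, HahnSeries.coeff_smul,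
        shiftDiff_coeff_of_vanish _ _ (hvan _), smul_zero] at h
      rcases hne i k with h' | h'
      · exact (mul_eq_zero.1 h).resolve_left (Rat.cast_ne_zero.2 h')
      · exact h'
  exact fun i => eq_zero_of_forall_coeff (hy i) fun k => key k i

end System

/-! ### Reduction of the matrix equation to its first column -/

section Matrices

theorem shiftBy_sVar_mul (t : ℤ) (f : Ser Cs) : shiftBy t (sVar * f) = sVar * shiftBy t f :=
  shiftBy_C_mul t _ f

theorem sVar_ne_zero : sVar ≠ 0 := HahnSeries.C_ne_zero RatFunc.X_ne_zero

theorem shiftBy_eq_zero_iff {K : Type} [Field K] [CharZero K] (t : ℤ) (f : Ser K) :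
    shiftBy t f = 0 ↔ f = 0 := by
  refine ⟨fun h => ?_, fun h => by rw [h, shiftBy_zero_right]⟩
  have := congrArg (shiftBy (-t)) h
  rwa [shiftBy_shiftBy, neg_add_cancel, shiftBy_zero, shiftBy_zero_right] at this

theorem shiftBy_diffOp {K : Type} [Field K] [CharZero K] (u c t : ℤ) (f : Ser K) :
    shiftBy u (diffOp c t f) = (zHalf K + (c + u : ℤ)) * shiftBy (u + t) f -
      (zHalf K + (1 + u : ℤ)) * shiftBy u f := by
  have h := shiftBy_zHalf_add_mul u 1 f
  rw [Int.cast_one] at h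
  rw [diffOp, shiftBy_sub, shiftBy_zHalf_add_mul, shiftBy_shiftBy, h]

theorem shiftBy_shiftDiff {K : Type} [Field K] [CharZero K] (u v w : ℤ) (f : Ser K) :
    shiftBy u (shiftDiff v w f) = shiftBy (u + v) f - shiftBy (u + w) f := by
  rw [shiftDiff, shiftBy_sub, shiftBy_shiftBy, shiftBy_shiftBy]

theorem W_apply (m₁ m₂ : ℕ) (p r : Fin (m₁ + m₂)) :
    W m₁ m₂ p r = (if p.val = 0 then
      ((if r.val + 1 = m₁ then zHalf Cs else 0) - if r.val + 1 = m₁ + m₂ then sVar else 0) else 0)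
      + if p.val = r.val + 1 then sVar else 0 := by
  have hsum : (∑ i ∈ Finset.Icc 2 (m₁ + m₂),
      (eUnit (m₁ + m₂) i (i - 1) : Matrix (Fin (m₁ + m₂)) (Fin (m₁ + m₂)) (Ser Cs))) p r =
      if p.val = r.val + 1 then 1 else 0 := by
    rw [Matrix.sum_apply]
    simp only [eUnit, Matrix.of_apply]
    have hp := p.2
    have hr := r.2
    split_ifs with h
    · rw [Finset.sum_eq_single (p.val + 1)]
      · rw [if_pos ⟨rfl, by omega⟩]
      · intro i _ hi
        rw [if_neg fun h' => hi h'.1.symm]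
      · intro h'
        exact absurd (Finset.mem_Icc.2 ⟨by omega, by omega⟩) h'
    · refine Finset.sum_eq_zero fun i hi => if_neg fun h' => h ?_
      have := Finset.mem_Icc.1 hi
      omega
  rw [W, Matrix.add_apply, Matrix.sub_apply, Matrix.smul_apply, Matrix.smul_apply,
    Matrix.smul_apply, hsum]
  simp only [eUnit, Matrix.of_apply, zHalf, smul_eq_mul, mul_ite, mul_one, mul_zero, add_left_inj]
  by_cases h : p.val = 0 <;> simp [h]

theorem mul_apply_eq_sum_range {R : Type*} [NonUnitalNonAssocSemiring R] {l : ℕ}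
    (A B : Matrix (Fin l) (Fin l) R) (i j : Fin l) (g : ℕ → R)
    (h : ∀ k : Fin l, A i k * B k j = g k) : (A * B) i j = ∑ k ∈ Finset.range l, g k := by
  rw [Matrix.mul_apply, ← Fin.sum_univ_eq_sum_range]
  exact Finset.sum_congr rfl fun k _ => h k

/-- The `(i, j)` entry of `M(z-1) W(z) - W(z) M(z)` for the matrix `M` with entries `F i j`. -/
def tdeEntry (m₁ m₂ : ℕ) (F : ℕ → ℕ → Ser Cs) (i j : ℕ) : Ser Cs :=
  shiftBy (-1) (F i 0) *
      ((if j + 1 = m₁ then zHalf Cs else 0) - if j + 1 = m₁ + m₂ then sVar else 0)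
    + (if j + 1 < m₁ + m₂ then sVar * shiftBy (-1) (F i (j + 1)) else 0)
    - if i = 0 then zHalf Cs * F (m₁ - 1) j - sVar * F (m₁ + m₂ - 1) j else sVar * F (i - 1) j

theorem map_shift_mul_W_sub (m₁ m₂ : ℕ) (hm₁ : 1 ≤ m₁) (hm₂ : 1 ≤ m₂) (F : ℕ → ℕ → Ser Cs)
    (M : Matrix (Fin (m₁ + m₂)) (Fin (m₁ + m₂)) (Ser Cs)) (hM : ∀ i j, M i j = F i j)
    (i j : Fin (m₁ + m₂)) :
    (M.map shift * W m₁ m₂) i j - (W m₁ m₂ * M) i j = tdeEntry m₁ m₂ F i j := by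
  have hi := i.2
  have hj := j.2
  rw [tdeEntry]
  congr 1
  · refine (mul_apply_eq_sum_range _ _ i j (fun k : ℕ => (if k = 0 then shiftBy (-1) (F i k) *
          ((if j.val + 1 = m₁ then zHalf Cs else 0) -
            if j.val + 1 = m₁ + m₂ then sVar else 0) else 0) +
          if k = j.val + 1 then sVar * shiftBy (-1) (F i k) else 0) fun k => ?_).trans ?_
    · rw [Matrix.map_apply, hM, shift_eq_shiftBy, W_apply, mul_add, mul_ite, mul_ite, mul_zero,
        mul_comm _ sVar]
    · rw [Finset.sum_add_distrib, Finset.sum_ite_eq', Finset.sum_ite_eq',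
        if_pos (Finset.mem_range.2 (by omega))]
      simp only [Finset.mem_range]
  · refine (mul_apply_eq_sum_range _ _ i j (fun k : ℕ => (if k = m₁ - 1 then (if i.val = 0 then zHalf Cs * F k j else 0) else 0) -
          (if k = m₁ + m₂ - 1 then (if i.val = 0 then sVar * F k j else 0) else 0) +
          if k = i.val - 1 then (if i.val = 0 then 0 else sVar * F k j) else 0) fun k => ?_).trans ?_
    · have hk := k.2
      rw [hM, W_apply]
      have e₁ : k.val + 1 = m₁ ↔ k.val = m₁ - 1 := by omega
      have e₂ : k.val + 1 = m₁ + m₂ ↔ k.val = m₁ + m₂ - 1 := by omega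
      by_cases h0 : i.val = 0
      · simp [h0, e₁, e₂, sub_mul]
      · have e₃ : i.val = k.val + 1 ↔ k.val = i.val - 1 := by omega
        simp [h0, e₃]
    · rw [Finset.sum_add_distrib, Finset.sum_sub_distrib, Finset.sum_ite_eq',
        Finset.sum_ite_eq', Finset.sum_ite_eq', if_pos (Finset.mem_range.2 (by omega)),
        if_pos (Finset.mem_range.2 (by omega)), if_pos (Finset.mem_range.2 (by omega))]
      split_ifs <;> simp

theorem tdeEntry_sub (m₁ m₂ : ℕ) (F G : ℕ → ℕ → Ser Cs) (i j : ℕ) :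
    tdeEntry m₁ m₂ (fun i j => F i j - G i j) i j = tdeEntry m₁ m₂ F i j - tdeEntry m₁ m₂ G i j := by
  simp only [tdeEntry, shiftBy_sub]
  split_ifs <;> ring

/-- The rows of the equation below the first determine a solution from its first column. -/
theorem eq_zero_of_tdeEntry_succ {m₁ m₂ : ℕ} {F : ℕ → ℕ → Ser Cs}
    (h0 : ∀ i < m₁ + m₂, F i 0 = 0)
    (h : ∀ i j, i + 1 < m₁ + m₂ → j < m₁ + m₂ → tdeEntry m₁ m₂ F (i + 1) j = 0)
    {i j : ℕ} (hi : i < m₁ + m₂) (hj : j < m₁ + m₂) : F i j = 0 := by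
  have step (i j : ℕ) (hi : i + 1 < m₁ + m₂) (hj : j + 1 < m₁ + m₂) :
      F i j = shiftBy (-1) (F (i + 1) (j + 1)) := by
    have := h i j hi (by omega)
    rw [tdeEntry, h0 _ hi, shiftBy_zero_right, if_pos hj, if_neg (Nat.succ_ne_zero i), zero_mul,
      zero_add, Nat.add_sub_cancel, ← mul_sub, mul_eq_zero, or_iff_right sVar_ne_zero,
      sub_eq_zero] at this
    exact this.symm
  have last (i : ℕ) (hi : i + 1 < m₁ + m₂) : F i (m₁ + m₂ - 1) = 0 := by
    have := h i (m₁ + m₂ - 1) hi (by omega)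
    rw [tdeEntry, h0 _ hi, shiftBy_zero_right, if_neg (Nat.succ_ne_zero i), zero_mul,
      zero_add, Nat.add_sub_cancel, if_neg (by omega), zero_sub, neg_eq_zero, mul_eq_zero,
      or_iff_right sVar_ne_zero] at this
    exact this
  -- On or below the main diagonal, each diagonal starts in the vanishing first column; above it,
  -- each diagonal ends in the vanishing last column.
  have lower (j : ℕ) : ∀ i, i < m₁ + m₂ → j ≤ i → F i j = 0 := by
    induction j with
    | zero => exact fun i hi _ => h0 i hi
    | succ j ih =>
      intro i hi hij
      obtain ⟨i, rfl⟩ := Nat.exists_eq_add_of_le' (show 1 ≤ i by omega)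
      rw [← shiftBy_eq_zero_iff (-1), ← step i j hi (by omega)]
      exact ih i (by omega) (by omega)
  have upper (n : ℕ) : ∀ i j, j + n + 1 = m₁ + m₂ → i < j → F i j = 0 := by
    induction n with
    | zero =>
      intro i j hj hij
      rw [show j = m₁ + m₂ - 1 by omega]
      exact last i (by omega)
    | succ n ih =>
      intro i j hj hij
      rw [step i j (by omega) (by omega), ih (i + 1) (j + 1) (by omega) (by omega),
        shiftBy_zero_right]
  rcases le_or_gt j i with hij | hij
  · exact lower j i hi hij
  · exact upper (m₁ + m₂ - 1 - j) i j (by omega) hij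

/-- The `(i, j)` entry of the matrix built from a sequence `y` vanishing outside `[0, l)`; its first
column is `s * y`. -/
def solEntry (m₁ m₂ : ℕ) (y : ℤ → Ser Cs) (i j : ℕ) : Ser Cs :=
  sVar * shiftBy j (y (i - j)) - sVar * shiftBy (j - (m₁ + m₂)) (y (i - j + (m₁ + m₂)))
    + (((if i < j then 1 else 0) - (if m₁ ≤ j then 1 else 0) : ℤ) : Ser Cs) *
      ((zHalf Cs + (1 + j - m₁ : ℤ)) * shiftBy (j - m₁) (y (i - j + m₁)))

variable {m₁ m₂ : ℕ} {y : ℤ → Ser Cs}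

/-- The single formula of `solEntry` splits into four regions, according to the side of the main
diagonal and of column m₁: since `y` vanishes outside [0, l), at most one of the two terms with
factor s survives in each. -/
theorem solEntry_of_le_of_lt (hy : ∀ n, n < 0 ∨ (m₁ + m₂ : ℤ) ≤ n → y n = 0) {i j : ℕ}
    (h : j ≤ i) (h' : j < m₁) : solEntry m₁ m₂ y i j = sVar * shiftBy j (y (i - j)) := by
  rw [solEntry, hy (i - j + (m₁ + m₂)) (by omega), if_neg (by omega), if_neg (by omega),
    shiftBy_zero_right]
  simp

theorem solEntry_of_lt_of_lt (hy : ∀ n, n < 0 ∨ (m₁ + m₂ : ℤ) ≤ n → y n = 0) {i j : ℕ}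
    (h : i < j) (h' : j < m₁) : solEntry m₁ m₂ y i j =
      (zHalf Cs + (1 + j - m₁ : ℤ)) * shiftBy (j - m₁) (y (i - j + m₁)) -
        sVar * shiftBy (j - (m₁ + m₂)) (y (i - j + (m₁ + m₂))) := by
  rw [solEntry, hy (i - j) (by omega), if_pos h, if_neg (by omega), shiftBy_zero_right]
  push_cast
  ring

theorem solEntry_of_le_of_le (hy : ∀ n, n < 0 ∨ (m₁ + m₂ : ℤ) ≤ n → y n = 0) {i j : ℕ}
    (h : j ≤ i) (h' : m₁ ≤ j) : solEntry m₁ m₂ y i j =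
      sVar * shiftBy j (y (i - j)) -
        (zHalf Cs + (1 + j - m₁ : ℤ)) * shiftBy (j - m₁) (y (i - j + m₁)) := by
  rw [solEntry, hy (i - j + (m₁ + m₂)) (by omega), if_neg (by omega), if_pos h', shiftBy_zero_right]
  push_cast
  ring

theorem solEntry_of_lt_of_le (hy : ∀ n, n < 0 ∨ (m₁ + m₂ : ℤ) ≤ n → y n = 0) {i j : ℕ}
    (h : i < j) (h' : m₁ ≤ j) : solEntry m₁ m₂ y i j =
      -(sVar * shiftBy (j - (m₁ + m₂)) (y (i - j + (m₁ + m₂)))) := by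
  rw [solEntry, hy (i - j) (by omega), if_pos h, if_pos h', shiftBy_zero_right]
  push_cast
  ring

theorem solEntry_zero_right (hm₁ : 1 ≤ m₁)
    (hy : ∀ n, n < 0 ∨ (m₁ + m₂ : ℤ) ≤ n → y n = 0) (i : ℕ) :
    solEntry m₁ m₂ y i 0 = sVar * y i := by
  rw [solEntry_of_le_of_lt hy (Nat.zero_le i) (by omega)]
  simp [shiftBy_zero]

/-- A diagonal step leaves the region unchanged unless it enters column m₁, where W has the entry z
- 1/2 in its first row and the term with `zHalf` changes. -/
theorem shiftBy_solEntry_succ (hy : ∀ n, n < 0 ∨ (m₁ + m₂ : ℤ) ≤ n → y n = 0) (i j : ℕ)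
    (h : j + 1 ≠ m₁) :
    shiftBy (-1) (solEntry m₁ m₂ y (i + 1) (j + 1)) = solEntry m₁ m₂ y i j := by
  have e₁ : ((i + 1 : ℕ) : ℤ) - (j + 1 : ℕ) = i - j := by push_cast; ring
  have e₂ : -1 + ((j + 1 : ℕ) : ℤ) = j := by push_cast; ring
  have e₃ : -1 + (((j + 1 : ℕ) : ℤ) - m₁) = j - m₁ := by push_cast; ring
  have e₄ : -1 + (((j + 1 : ℕ) : ℤ) - (m₁ + m₂)) = j - (m₁ + m₂) := by push_cast; ring
  have e₅ : (1 + ((j + 1 : ℕ) : ℤ) - m₁) + -1 = 1 + j - m₁ := by push_cast; ring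
  rcases le_or_gt j i with hij | hij <;> rcases lt_or_gt_of_ne h with hj | hj
  · rw [solEntry_of_le_of_lt hy (by omega) (by omega), solEntry_of_le_of_lt hy hij (by omega),
      shiftBy_sVar_mul, shiftBy_shiftBy, e₁, e₂]
  · rw [solEntry_of_le_of_le hy (by omega) (by omega), solEntry_of_le_of_le hy hij (by omega),
      shiftBy_sub, shiftBy_sVar_mul, shiftBy_shiftBy, shiftBy_zHalf_add_mul, shiftBy_shiftBy,
      e₁, e₂, e₃, e₅]
  · rw [solEntry_of_lt_of_lt hy (by omega) (by omega), solEntry_of_lt_of_lt hy hij (by omega),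
      shiftBy_sub, shiftBy_sVar_mul, shiftBy_shiftBy, shiftBy_zHalf_add_mul, shiftBy_shiftBy,
      e₁, e₃, e₄, e₅]
  · rw [solEntry_of_lt_of_le hy (by omega) (by omega), solEntry_of_lt_of_le hy hij (by omega),
      shiftBy_neg, shiftBy_sVar_mul, shiftBy_shiftBy, e₁, e₄]

theorem tdeEntry_solEntry_succ (hm₁ : 1 ≤ m₁) (hm₂ : 1 ≤ m₂)
    (hy : ∀ n, n < 0 ∨ (m₁ + m₂ : ℤ) ≤ n → y n = 0) {i j : ℕ} (hi : i + 1 < m₁ + m₂)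
    (hj : j < m₁ + m₂) : tdeEntry m₁ m₂ (solEntry m₁ m₂ y) (i + 1) j = 0 := by
  rw [tdeEntry, if_neg (Nat.succ_ne_zero i), Nat.add_sub_cancel, solEntry_zero_right hm₁ hy,
    shiftBy_sVar_mul]
  rcases eq_or_ne (j + 1) m₁ with h | h
  · have e₁ : ((i + 1 : ℕ) : ℤ) - (j + 1 : ℕ) = i - j := by push_cast; ring
    have e₂ : -1 + ((j + 1 : ℕ) : ℤ) = j := by push_cast; ring
    have e₃ : -1 + (((j + 1 : ℕ) : ℤ) - m₁) = -1 := by rw [h]; ring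
    have e₄ : -1 + (((j + 1 : ℕ) : ℤ) - (m₁ + m₂)) = j - (m₁ + m₂) := by push_cast; ring
    have e₅ : (1 + ((j + 1 : ℕ) : ℤ) - m₁) + -1 = 0 := by rw [h]; ring
    have e₆ : (1 + (j : ℤ) - m₁) = 0 := by rw [← h]; push_cast; ring
    have e₇ : (j : ℤ) - m₁ = -1 := by rw [← h]; push_cast; ring
    have e₈ : (i : ℤ) - j + m₁ = (i + 1 : ℕ) := by rw [← h]; push_cast; ring
    rw [if_pos h, if_neg (by omega), if_pos (by omega)]
    rcases le_or_gt j i with hij | hij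
    · rw [solEntry_of_le_of_le hy (by omega) (by omega), solEntry_of_le_of_lt hy hij (by omega),
        shiftBy_sub, shiftBy_sVar_mul, shiftBy_shiftBy, shiftBy_zHalf_add_mul, shiftBy_shiftBy,
        e₁, e₂, e₃, e₅, e₈]
      push_cast
      ring
    · rw [solEntry_of_lt_of_le hy (by omega) (by omega), solEntry_of_lt_of_lt hy hij (by omega),
        shiftBy_neg, shiftBy_sVar_mul, shiftBy_shiftBy, e₁, e₄, e₆, e₇, e₈]
      push_cast
      ring
  · rw [if_neg h]
    rcases eq_or_ne (j + 1) (m₁ + m₂) with h' | h'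
    · have e₁ : (i : ℤ) - j + (m₁ + m₂) = (i + 1 : ℕ) := by
        rw [← Nat.cast_add m₁, ← h']; push_cast; ring
      have e₂ : (j : ℤ) - (m₁ + m₂) = -1 := by rw [← Nat.cast_add m₁, ← h']; push_cast; ring
      rw [if_pos h', if_neg (by omega), solEntry_of_lt_of_le hy (by omega) (by omega), e₁, e₂]
      ring
    · rw [if_neg h', if_pos (by omega), shiftBy_solEntry_succ hy i j h]
      ring

/-- The first row is not used in building `solEntry`, so it carries the actual constraints. Undoing
the shift by j - m₁ puts each of its entries in a form where j enters only through a constant and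
the indices of `y`. -/
theorem tdeEntry_solEntry_zero_of_lt (hm₁ : 1 ≤ m₁) (hm₂ : 1 ≤ m₂)
    (hy : ∀ n, n < 0 ∨ (m₁ + m₂ : ℤ) ≤ n → y n = 0) {j : ℕ} (hj : j < m₁) :
    tdeEntry m₁ m₂ (solEntry m₁ m₂ y) 0 j = -(sVar * shiftBy (j - m₁)
      (diffOp (m₁ - j) m₁ (y (m₁ - 1 - j)) -
        sVar * shiftDiff m₁ (-m₂) (y (m₁ - 1 - j + m₂)))) := by
  have c₁ : ((m₁ - 1 : ℕ) : ℤ) = m₁ - 1 := by omega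
  have c₂ : ((m₁ + m₂ - 1 : ℕ) : ℤ) = m₁ + m₂ - 1 := by omega
  have f₁ : (m₁ - j : ℤ) + (j - m₁) = 0 := by ring
  have f₂ : (j - m₁ : ℤ) + m₁ = j := by ring
  have f₃ : (j - m₁ : ℤ) + -m₂ = j - (m₁ + m₂) := by ring
  have f₄ : (m₁ + m₂ - 1 - j : ℤ) = m₁ - 1 - j + m₂ := by ring
  have f₅ : ((0 : ℕ) : ℤ) - (j + 1 : ℕ) + m₁ = m₁ - 1 - j := by push_cast; ring
  have f₆ : ((0 : ℕ) : ℤ) - (j + 1 : ℕ) + (m₁ + m₂) = m₁ - 1 - j + m₂ := by push_cast; ring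
  have f₇ : -1 + (((j + 1 : ℕ) : ℤ) - (m₁ + m₂)) = j - (m₁ + m₂) := by push_cast; ring
  rw [shiftBy_sub, shiftBy_diffOp, shiftBy_sVar_mul, shiftBy_shiftDiff, f₁, f₂, f₃, tdeEntry,
    if_neg (by omega : ¬j + 1 = m₁ + m₂), if_pos (by omega : j + 1 < m₁ + m₂), if_pos rfl,
    solEntry_zero_right hm₁ hy, solEntry_of_le_of_lt hy (by omega : j ≤ m₁ - 1) hj,
    solEntry_of_le_of_lt hy (by omega : j ≤ m₁ + m₂ - 1) hj, shiftBy_sVar_mul, c₁, c₂, f₄]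
  rcases eq_or_ne (j + 1) m₁ with h | h
  · have e₁ : (m₁ - 1 - j : ℤ) = 0 := by omega
    have e₂ : (j - m₁ : ℤ) = -1 := by omega
    rw [if_pos h, solEntry_of_lt_of_le hy (by omega) (by omega), shiftBy_neg, shiftBy_sVar_mul,
      shiftBy_shiftBy, f₆, f₇, e₁, e₂]
    push_cast
    ring
  · have e₁ : (1 + ((j + 1 : ℕ) : ℤ) - m₁) + -1 = 1 + (j - m₁) := by push_cast; ring
    have e₂ : -1 + (((j + 1 : ℕ) : ℤ) - m₁) = j - m₁ := by push_cast; ring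
    rw [if_neg h, solEntry_of_lt_of_lt hy (by omega) (by omega), shiftBy_sub, shiftBy_sVar_mul,
      shiftBy_shiftBy, shiftBy_zHalf_add_mul, shiftBy_shiftBy, f₅, f₆, f₇, e₁, e₂]
    push_cast
    ring

theorem tdeEntry_solEntry_zero_of_le (hm₁ : 1 ≤ m₁)
    (hy : ∀ n, n < 0 ∨ (m₁ + m₂ : ℤ) ≤ n → y n = 0) {j : ℕ} (hj : m₁ ≤ j) (hj' : j < m₁ + m₂) :
    tdeEntry m₁ m₂ (solEntry m₁ m₂ y) 0 j = sVar * shiftBy (j - m₁)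
      (diffOp (m₁ - j) (-m₂) (y (m₁ + m₂ - 1 - j + m₁)) +
        sVar * shiftDiff m₁ (-m₂) (y (m₁ + m₂ - 1 - j))) := by
  have c₁ : ((m₁ - 1 : ℕ) : ℤ) = m₁ - 1 := by omega
  have c₂ : ((m₁ + m₂ - 1 : ℕ) : ℤ) = m₁ + m₂ - 1 := by omega
  have f₁ : (m₁ - j : ℤ) + (j - m₁) = 0 := by ring
  have f₂ : (j - m₁ : ℤ) + m₁ = j := by ring
  have f₃ : (j - m₁ : ℤ) + -m₂ = j - (m₁ + m₂) := by ring
  have f₄ : (m₁ - 1 - j : ℤ) + (m₁ + m₂) = m₁ + m₂ - 1 - j + m₁ := by ring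
  have f₆ : ((0 : ℕ) : ℤ) - (j + 1 : ℕ) + (m₁ + m₂) = m₁ + m₂ - 1 - j := by push_cast; ring
  have f₇ : -1 + (((j + 1 : ℕ) : ℤ) - (m₁ + m₂)) = j - (m₁ + m₂) := by push_cast; ring
  rw [shiftBy_add, shiftBy_diffOp, shiftBy_sVar_mul, shiftBy_shiftDiff, f₁, f₂, f₃, tdeEntry,
    if_neg (by omega : ¬j + 1 = m₁), if_pos rfl, solEntry_zero_right hm₁ hy,
    solEntry_of_lt_of_le hy (by omega : m₁ - 1 < j) hj,
    solEntry_of_le_of_le hy (by omega : j ≤ m₁ + m₂ - 1) hj, shiftBy_sVar_mul, c₁, c₂, f₄]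
  rcases eq_or_ne (j + 1) (m₁ + m₂) with h | h
  · have e₁ : (m₁ + m₂ - 1 - j : ℤ) = 0 := by omega
    have e₂ : (j - (m₁ + m₂) : ℤ) = -1 := by omega
    rw [if_pos h, if_neg (by omega), e₁, e₂]
    push_cast
    ring
  · rw [if_neg h, if_pos (by omega), solEntry_of_lt_of_le hy (by omega) (by omega), shiftBy_neg,
      shiftBy_sVar_mul, shiftBy_shiftBy, f₆, f₇]
    push_cast
    ring

end Matrices

/-! ### The scalar system: indicial roots, existence and uniqueness -/

section Solutions

/-- The constants `c` of the scalar equations `diffOp c t (y n) = e * shiftDiff m₁ (-m₂) (y (σ n))`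
to which the matrix equation reduces. -/
def sysConst (m₁ m₂ : ℕ) (n : ℤ) : ℤ := if n < m₁ then n + 1 else n + 1 - (m₁ + m₂)

/-- The shifts `t` of the scalar equations. -/
def sysShift (m₁ m₂ : ℕ) (n : ℤ) : ℤ := if n < m₁ then m₁ else -m₂

/-- The coefficients `e` of the scalar equations. -/
def sysCoeff (m₁ : ℕ) (n : ℤ) : Cs := if n < m₁ then RatFunc.X else -RatFunc.X

/-- The permutation `σ` of the indices of the scalar equations. -/
def sysPerm (m₁ m₂ : ℕ) (n : ℤ) : ℤ := if n < m₁ then n + m₂ else n - m₁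

/-- The scalar equation with index `n`. -/
def IsSysSol (m₁ m₂ : ℕ) (y : ℤ → Ser Cs) (n : ℤ) : Prop :=
  diffOp (sysConst m₁ m₂ n) (sysShift m₁ m₂ n) (y n) =
    HahnSeries.C (sysCoeff m₁ n) * shiftDiff m₁ (-m₂) (y (sysPerm m₁ m₂ n))

/-- The indicial factors, displaying the roots n / m₁ and (l - n) / m₂. -/
theorem sysConst_sub (m₁ m₂ : ℕ) (n : ℤ) (r : ℚ) :
    (sysConst m₁ m₂ n - 1 - sysShift m₁ m₂ n * r : ℚ) =
      if n < m₁ then n - m₁ * r else n - (m₁ + m₂) + m₂ * r := by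
  rw [sysConst, sysShift]
  split_ifs <;> push_cast <;> ring

variable {m₁ m₂ : ℕ} {y : ℤ → Ser Cs}

/-- Column j of the first row gives the equation of index m₁ - 1 - j if j < m₁, and l - 1 - j + m₁
otherwise. This exhausts [0, l). -/
theorem tdeEntry_solEntry_eq_zero_iff (hm₁ : 1 ≤ m₁) (hm₂ : 1 ≤ m₂)
    (hy : ∀ n, n < 0 ∨ (m₁ + m₂ : ℤ) ≤ n → y n = 0) :
    (∀ i j, i < m₁ + m₂ → j < m₁ + m₂ → tdeEntry m₁ m₂ (solEntry m₁ m₂ y) i j = 0) ↔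
      ∀ n : ℤ, 0 ≤ n → n < m₁ + m₂ → IsSysSol m₁ m₂ y n := by
  have lt_iff (j : ℕ) (hj : j < m₁) : tdeEntry m₁ m₂ (solEntry m₁ m₂ y) 0 j = 0 ↔
      IsSysSol m₁ m₂ y (m₁ - 1 - j) := by
    have h : (m₁ - 1 - j : ℤ) < m₁ := by omega
    rw [tdeEntry_solEntry_zero_of_lt hm₁ hm₂ hy hj, neg_eq_zero, mul_eq_zero,
      or_iff_right sVar_ne_zero, shiftBy_eq_zero_iff, sub_eq_zero, IsSysSol, sysConst, sysShift,
      sysCoeff, sysPerm, if_pos h, if_pos h, if_pos h, if_pos h, sVar,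
      show (m₁ - 1 - j + 1 : ℤ) = m₁ - j by ring]
  have le_iff (j : ℕ) (hj : m₁ ≤ j) (hj' : j < m₁ + m₂) :
      tdeEntry m₁ m₂ (solEntry m₁ m₂ y) 0 j = 0 ↔
      IsSysSol m₁ m₂ y (m₁ + m₂ - 1 - j + m₁) := by
    have h : ¬(m₁ + m₂ - 1 - j + m₁ : ℤ) < m₁ := by omega
    rw [tdeEntry_solEntry_zero_of_le hm₁ hy hj hj', mul_eq_zero,
      or_iff_right sVar_ne_zero, shiftBy_eq_zero_iff, add_eq_zero_iff_eq_neg, IsSysSol, sysConst,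
      sysShift, sysCoeff, sysPerm, if_neg h, if_neg h, if_neg h, if_neg h, sVar, map_neg, neg_mul,
      show (m₁ + m₂ - 1 - j + m₁ + 1 - (m₁ + m₂) : ℤ) = m₁ - j by ring, add_sub_cancel_right]
  constructor
  · intro h n hn hn'
    rcases lt_or_ge n m₁ with hlt | hge
    · have := (lt_iff (m₁ - 1 - n).toNat (by omega)).1 (h 0 _ (by omega) (by omega))
      rwa [show (m₁ - 1 - ((m₁ - 1 - n).toNat : ℤ)) = n by omega] at this
    · have := (le_iff (m₁ + m₂ - 1 - (n - m₁)).toNat (by omega) (by omega)).1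
        (h 0 _ (by omega) (by omega))
      rwa [show (m₁ + m₂ - 1 - ((m₁ + m₂ - 1 - (n - m₁)).toNat : ℤ) + m₁) = n by omega] at this
  · intro h i j hi hj
    rcases i with _ | i
    · rcases lt_or_ge j m₁ with hlt | hge
      · exact (lt_iff j hlt).2 (h _ (by omega) (by omega))
      · exact (le_iff j hge hj).2 (h _ (by omega) (by omega))
    · exact tdeEntry_solEntry_succ hm₁ hm₂ hy hi hj

theorem solEntry_mem_gradedSeries {P : Subalgebra ℚ Cs} (hP : RatFunc.X ∈ P) {ρ : ℚ}
    (hy : ∀ n, y n ∈ gradedSeries P ρ) (i j : ℕ) :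
    solEntry m₁ m₂ y i j ∈ gradedSeries P (ρ - 1) := by
  have h (t n : ℤ) : sVar * shiftBy t (y n) ∈ gradedSeries P (ρ - 1) :=
    gradedSeries_sub_one (C_mul_mem_gradedSeries hP (shiftBy_mem_gradedSeries t (hy n)))
  exact AddSubgroup.add_mem _ (AddSubgroup.sub_mem _ (h _ _) (h _ _))
    (intCast_mul_mem_gradedSeries _ (zHalf_add_mul_mem_gradedSeries _
      (shiftBy_mem_gradedSeries _ (hy _))))

/-- Only the term multiplied by z reaches the order z^(1 - ρ). -/
theorem solEntry_coeff {P : Subalgebra ℚ Cs} {ρ : ℚ} (hy : ∀ n, y n ∈ gradedSeries P ρ)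
    (i j : ℕ) : (solEntry m₁ m₂ y i j).coeff (ρ - 1) =
      (((if i < j then 1 else 0) - (if m₁ ≤ j then 1 else 0) : ℤ) : Cs) *
        (y (i - j + m₁)).coeff ρ := by
  have h (t n : ℤ) : (shiftBy t (y n)).coeff (ρ - 1) = 0 :=
    coeff_eq_zero_of_lt (shiftBy_mem_gradedSeries t (hy n)) (by linarith)
  rw [solEntry, sVar, HahnSeries.C_mul_eq_smul, HahnSeries.C_mul_eq_smul, HahnSeries.coeff_add,
    HahnSeries.coeff_sub, HahnSeries.coeff_smul, HahnSeries.coeff_smul, h, h, coeff_intCast_mul,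
    add_mul, HahnSeries.coeff_add, coeff_zHalf_mul, coeff_intCast_mul, h, sub_add_cancel,
    shiftBy_coeff_of_vanish _ fun r hr => coeff_eq_zero_of_lt (hy _) hr]
  simp

theorem q_pos (hm₁ : 1 ≤ m₁) (hm₂ : 1 ≤ m₂) {a : ℕ} (ha₁ : 1 ≤ a) (ha₂ : a ≤ m₁ + m₂ - 1) :
    0 < q m₁ m₂ a := by
  rw [q]
  have h₁ : (0 : ℚ) < m₁ := by exact_mod_cast hm₁
  have h₂ : (0 : ℚ) < m₂ := by exact_mod_cast hm₂
  split_ifs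
  · exact div_pos (by exact_mod_cast ha₁) h₁
  · refine div_pos (sub_pos.2 ?_) h₂
    exact_mod_cast (by omega : a < m₁ + m₂)

/-- There is no resonance beyond the leading term. -/
theorem sysConst_sub_ne_zero (hm₁ : 1 ≤ m₁) (hm₂ : 1 ≤ m₂) {ρ : ℚ} (hρ : 0 < ρ) {n : ℤ}
    (hn : 0 ≤ n) (hn' : n < m₁ + m₂) (k : ℕ) (h : n = 0 ∨ k ≠ 0) :
    (sysConst m₁ m₂ n - 1 - sysShift m₁ m₂ n * (ρ + k) : ℚ) ≠ 0 := by
  have h₁ : (0 : ℚ) < m₁ := by exact_mod_cast hm₁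
  have h₂ : (0 : ℚ) < m₂ := by exact_mod_cast hm₂
  rw [sysConst_sub]
  split_ifs with hlt
  -- The roots are at most 1, whereas ρ + k > 1 once k ≥ 1; for n = 0 the root is 0 < ρ.
  · refine (sub_neg.2 ?_).ne
    rcases h with rfl | h
    · have : (0 : ℚ) ≤ k := k.cast_nonneg
      rw [Int.cast_zero]
      positivity
    · have hk : (1 : ℚ) ≤ k := by exact_mod_cast Nat.one_le_iff_ne_zero.2 h
      have hn'' : (n : ℚ) < m₁ := by exact_mod_cast hlt
      nlinarith
  · have hk : (1 : ℚ) ≤ k := by exact_mod_cast Nat.one_le_iff_ne_zero.2 (h.resolve_left (by omega))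
    have hn'' : (m₁ : ℚ) ≤ n := by exact_mod_cast not_lt.1 hlt
    nlinarith

theorem sysConst_sub_q_eq_zero (hm₁ : 1 ≤ m₁) (hm₂ : 1 ≤ m₂) (a : ℕ) :
    (sysConst m₁ m₂ a - 1 - sysShift m₁ m₂ a * q m₁ m₂ a : ℚ) = 0 := by
  have h₁ : (m₁ : ℚ) ≠ 0 := by exact_mod_cast (by omega : m₁ ≠ 0)
  have h₂ : (m₂ : ℚ) ≠ 0 := by exact_mod_cast (by omega : m₂ ≠ 0)
  rw [sysConst_sub, q]
  rcases lt_trichotomy a m₁ with h | rfl | h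
  · rw [if_pos (by exact_mod_cast h), if_pos h.le, mul_div_cancel₀ _ h₁, Int.cast_natCast, sub_self]
  -- At a = m₁ the definitions of `q` and of the system take different branches, but both give the
  -- root 1.
  · rw [if_neg (by omega), if_pos le_rfl, div_self h₁, Int.cast_natCast]
    ring
  · rw [if_neg (by omega), if_neg (by omega), mul_div_cancel₀ _ h₂, Int.cast_natCast]
    ring

/-- A solution of the scalar equations with leading term `z ^ (-q_a)` in the place `a`. -/
theorem exists_sysSol (hm₁ : 1 ≤ m₁) (hm₂ : 1 ≤ m₂) {a : ℕ} (ha₁ : 1 ≤ a)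
    (ha₂ : a ≤ m₁ + m₂ - 1) {P : Subalgebra ℚ Cs} (hP : RatFunc.X ∈ P) :
    ∃ y : ℤ → Ser Cs, (∀ n, n < 0 ∨ (m₁ + m₂ : ℤ) ≤ n → y n = 0) ∧
      (∀ n, y n ∈ gradedSeries P (q m₁ m₂ a)) ∧
      (∀ n, (y n).coeff (q m₁ m₂ a) = if n = a then 1 else 0) ∧
      ∀ n : ℤ, 0 ≤ n → n < m₁ + m₂ → IsSysSol m₁ m₂ y n := by
  obtain ⟨y, hmem, hlead, hsys⟩ := exists_system_solution P (q m₁ m₂ a) (sysConst m₁ m₂)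
    (sysShift m₁ m₂) m₁ (-m₂) (sysCoeff m₁) (fun n => by
      rw [sysCoeff]
      split_ifs
      · exact hP
      · exact P.neg_mem hP) (sysPerm m₁ m₂) (fun n : ℤ => if n = a then 1 else 0) (fun n => by
      split_ifs
      · exact P.one_mem
      · exact P.zero_mem)
  -- The recursion was run over all integer indices. Cutting down to [0, l) is harmless because σ
  -- preserves that interval.
  refine ⟨fun n => if 0 ≤ n ∧ n < m₁ + m₂ then y n else 0, fun n hn => if_neg (by omega),
    fun n => ?_, fun n => ?_, fun n hn hn' => ?_⟩
  · beta_reduce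
    split_ifs
    · exact hmem n
    · exact AddSubgroup.zero_mem _
  · beta_reduce
    by_cases h : 0 ≤ n ∧ n < m₁ + m₂
    · rw [if_pos h, hlead]
    · rw [if_neg h, if_neg (by omega), HahnSeries.coeff_zero]
  · have hperm : 0 ≤ sysPerm m₁ m₂ n ∧ sysPerm m₁ m₂ n < m₁ + m₂ := by
      rw [sysPerm]
      split_ifs <;> omega
    rw [IsSysSol, if_pos ⟨hn, hn'⟩, if_pos hperm]
    refine hsys n ?_ fun k => sysConst_sub_ne_zero hm₁ hm₂ (q_pos hm₁ hm₂ ha₁ ha₂) hn hn' _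
      (Or.inr k.succ_ne_zero)
    split_ifs with h
    · rw [h, sysConst_sub_q_eq_zero hm₁ hm₂, Rat.cast_zero, zero_mul]
    · rw [mul_zero]

/-- No condition is needed on the leading coefficient at n = 0, where the indicial root 0 is
excluded by ρ > 0. -/
theorem sysSol_eq_zero (hm₁ : 1 ≤ m₁) (hm₂ : 1 ≤ m₂) {P : Subalgebra ℚ Cs} {ρ : ℚ} (hρ : 0 < ρ)
    (hy : ∀ n, n < 0 ∨ (m₁ + m₂ : ℤ) ≤ n → y n = 0) (hmem : ∀ n, y n ∈ gradedSeries P ρ)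
    (hlead : ∀ n ≠ 0, (y n).coeff ρ = 0)
    (hsys : ∀ n : ℤ, 0 ≤ n → n < m₁ + m₂ → IsSysSol m₁ m₂ y n) (n : ℤ) : y n = 0 := by
  by_cases hn : 0 ≤ n ∧ n < m₁ + m₂
  · have hperm (n : {n : ℤ // 0 ≤ n ∧ n < m₁ + m₂}) :
        0 ≤ sysPerm m₁ m₂ n ∧ sysPerm m₁ m₂ n < m₁ + m₂ := by
      have := n.2
      rw [sysPerm]
      split_ifs <;> omega
    refine system_solution_eq_zero (ι := {n : ℤ // 0 ≤ n ∧ n < m₁ + m₂}) P ρ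
      (fun n => sysConst m₁ m₂ n) (fun n => sysShift m₁ m₂ n) m₁ (-m₂) (fun n => sysCoeff m₁ n)
      (fun n => ⟨sysPerm m₁ m₂ n, hperm n⟩) (fun n => y n) (fun n => hmem n) (fun n k => ?_)
      (fun n => hsys n n.2.1 n.2.2) ⟨n, hn⟩
    by_cases h : n.1 = 0 ∨ k ≠ 0
    · exact Or.inl (sysConst_sub_ne_zero hm₁ hm₂ hρ n.2.1 n.2.2 k h)
    · push Not at h
      right
      rw [h.2, Nat.cast_zero, add_zero, hlead _ h.1]
  · exact hy n (by omega)

/-- The homogeneous statement behind uniqueness. -/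
theorem eq_zero_of_tdeEntry (hm₁ : 1 ≤ m₁) (hm₂ : 1 ≤ m₂) {ρ : ℚ} (hρ : 0 < ρ)
    {F : ℕ → ℕ → Ser Cs} (hF : ∀ i j, i < m₁ + m₂ → j < m₁ + m₂ → F i j ∈ gradedSeries ⊤ ρ)
    (h : ∀ i j, i < m₁ + m₂ → j < m₁ + m₂ → tdeEntry m₁ m₂ F i j = 0) {i j : ℕ}
    (hi : i < m₁ + m₂) (hj : j < m₁ + m₂) : F i j = 0 := by
  let y : ℤ → Ser Cs := fun n =>
    if 0 ≤ n ∧ n < m₁ + m₂ then HahnSeries.C (RatFunc.X)⁻¹ * F n.toNat 0 else 0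
  have hy (n : ℤ) (hn : n < 0 ∨ (m₁ + m₂ : ℤ) ≤ n) : y n = 0 := if_neg (by omega)
  have hmem (n : ℤ) : y n ∈ gradedSeries ⊤ ρ := by
    simp only [y]
    split_ifs with hn
    · exact C_mul_mem_gradedSeries Algebra.mem_top (hF _ _ (by omega) (by omega))
    · exact AddSubgroup.zero_mem _
  have hcol (i : ℕ) (hi : i < m₁ + m₂) : F i 0 - solEntry m₁ m₂ y i 0 = 0 := by
    rw [solEntry_zero_right hm₁ hy]
    simp only [y]
    rw [if_pos (by omega), sVar, ← mul_assoc, ← map_mul, mul_inv_cancel₀ RatFunc.X_ne_zero, map_one,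
      one_mul, Int.toNat_natCast, sub_self]
  have hFy (i j : ℕ) (hi : i < m₁ + m₂) (hj : j < m₁ + m₂) : F i j = solEntry m₁ m₂ y i j :=
    sub_eq_zero.1 (eq_zero_of_tdeEntry_succ (F := fun i j => F i j - solEntry m₁ m₂ y i j) hcol
      (fun i j hi hj => by
        rw [tdeEntry_sub, h _ _ hi hj, tdeEntry_solEntry_succ hm₁ hm₂ hy hi hj, sub_zero]) hi hj)
  have hsys := (tdeEntry_solEntry_eq_zero_iff hm₁ hm₂ hy).1 fun i j hi hj => by
    rcases i with _ | i
    · rw [← h 0 j hi hj, tdeEntry, tdeEntry, hFy 0 0 hi (by omega), hFy (m₁ - 1) j (by omega) hj,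
        hFy (m₁ + m₂ - 1) j (by omega) hj]
      by_cases hj' : j + 1 < m₁ + m₂
      · rw [hFy 0 (j + 1) hi hj']
        rfl
      · rw [if_neg hj', if_neg hj']
        rfl
    · exact tdeEntry_solEntry_succ hm₁ hm₂ hy hi hj
  have hlow (i j : ℕ) (hi : i < m₁ + m₂) (hj : j < m₁ + m₂) :
      (solEntry m₁ m₂ y i j).coeff (ρ - 1) = 0 := by
    rw [← hFy i j hi hj]
    exact coeff_eq_zero_of_lt (hF i j hi hj) (by linarith)
  -- The leading coefficient of `y n` is visible, up to sign, at entry (n - 1, m₁ - 1) for 0 < n <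
  -- m₁ and at (n, m₁) for n ≥ m₁. That of `y 0` is not seen by this order.
  have hlead (n : ℤ) (hn : n ≠ 0) : (y n).coeff ρ = 0 := by
    by_cases hn' : 0 ≤ n ∧ n < m₁ + m₂
    · rcases lt_or_ge n m₁ with hlt | hge
      · have := hlow (n - 1).toNat (m₁ - 1) (by omega) (by omega)
        rw [solEntry_coeff hmem, if_pos (by omega), if_neg (by omega),
          show (((n - 1).toNat : ℤ) - (m₁ - 1 : ℕ) + m₁) = n by omega] at this
        simpa using this
      · have := hlow n.toNat m₁ (by omega) (by omega)
        rw [solEntry_coeff hmem, if_neg (by omega), if_pos le_rfl,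
          show ((n.toNat : ℤ) - m₁ + m₁) = n by omega] at this
        simpa using this
    · rw [hy n (by omega), HahnSeries.coeff_zero]
  have hy0 (n : ℤ) : y n = 0 := sysSol_eq_zero hm₁ hm₂ hρ hy hmem hlead hsys n
  rw [hFy i j hi hj, solEntry, hy0, hy0, hy0]
  simp [shiftBy_zero_right]

end Solutions

/-! ### Laurent and polynomial forms, and the matrix K_a -/

section Main

/-- The subring `ℚ[s]` of `ℂ(s)`. -/
def ratPolys : Subalgebra ℚ Cs :=
  { polyIncl.range with
    algebraMap_mem' := fun c => ⟨Polynomial.C c,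
      (eq_ratCast (polyIncl.comp Polynomial.C) c).trans (eq_ratCast (algebraMap ℚ Cs) c).symm⟩ }

theorem X_mem_ratPolys : RatFunc.X ∈ ratPolys :=
  ⟨Polynomial.X, by simp [polyIncl]⟩

theorem exists_ofRatPow {α : ℚ} {f : Ser Cs} (hf : f ∈ gradedSeries ratPolys (-α)) :
    ∃ p : PowerSeries (Polynomial ℚ), f = zpow Cs α * ofRatPow p := by
  choose p hp using fun k : ℕ => (hf (-α + k)).1
  refine ⟨PowerSeries.mk p, ?_⟩
  have h : ofRatPow (PowerSeries.mk p) = ofPow Cs (PowerSeries.mk fun k => f.coeff (-α + k)) := by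
    rw [ofRatPow, RingHom.comp_apply]
    congr 1
    ext k
    rw [PowerSeries.coeff_map, PowerSeries.coeff_mk, PowerSeries.coeff_mk]
    exact hp k
  have h' := eq_serOf hf
  rwa [serOf, ← h, neg_neg] at h'

variable {K : Type} [Field K]

theorem ofLaurent_ofPowerSeries (F : PowerSeries K) :
    ofLaurent K (HahnSeries.ofPowerSeries ℤ K F) = ofPow K F := by
  ext r
  by_cases h : ∃ n : ℕ, r = n
  · obtain ⟨n, rfl⟩ := h
    rw [ofPow_coeff_natCast]
    refine Eq.trans ?_ (HahnSeries.ofPowerSeries_apply_coeff (Γ := ℤ) F n)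
    exact HahnSeries.embDomain_coeff (f := ⟨⟨((↑) : ℤ → ℚ), Int.cast_injective⟩, Int.cast_le⟩)
      (a := (n : ℤ))
  · have h₀ : (ofPow K F).coeff r = 0 := by
      by_contra h'
      exact h (exists_of_ofPow_coeff_ne_zero F h')
    rw [h₀]
    by_cases h₁ : ∃ n : ℤ, (n : ℚ) = r
    · obtain ⟨n, rfl⟩ := h₁
      refine (HahnSeries.embDomain_coeff
        (f := ⟨⟨((↑) : ℤ → ℚ), Int.cast_injective⟩, Int.cast_le⟩) (a := n)).trans ?_
      rw [HahnSeries.ofPowerSeries_apply]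
      refine HahnSeries.embDomain_of_notMem_range ?_
      rintro ⟨k, rfl⟩
      exact h ⟨k, by simp⟩
    · refine HahnSeries.embDomain_of_notMem_range ?_
      rintro ⟨n, rfl⟩
      exact h₁ ⟨n, rfl⟩

theorem exists_ofLaurent [CharZero K] {P : Subalgebra ℚ K} {α : ℚ} {f : Ser K}
    (hf : f ∈ gradedSeries P (-α)) : ∃ g : LaurentSeries K, f = zpow K α * ofLaurent K g := by
  have h := eq_serOf hf
  rw [serOf, neg_neg, ← ofLaurent_ofPowerSeries] at h
  exact ⟨_, h⟩

theorem exists_leading [CharZero K] {P : Subalgebra ℚ K} {α : ℚ} {f : Ser K}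
    (hf : f ∈ gradedSeries P (-α)) {κ : K} (hκ : f.coeff (-α) = κ) :
    ∃ g : PowerSeries K, f = zpow K α * (HahnSeries.C κ + zpow K (-1) * ofPow K g) := by
  refine ⟨PowerSeries.mk fun k => f.coeff (-α + (k + 1 : ℕ)), (eq_serOf hf).trans ?_⟩
  rw [serOf, neg_neg]
  congr 1
  have hC : (HahnSeries.C κ : Ser K) = ofPow K (PowerSeries.C κ) :=
    (HahnSeries.ofPowerSeries_C κ).symm
  have hX : zpow K (-1) = ofPow K PowerSeries.X := by
    rw [zpow, neg_neg]
    exact HahnSeries.ofPowerSeries_X.symm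
  rw [hC, hX, ← map_mul, ← map_add]
  congr 1
  ext n
  rcases n with _ | n
  · simp [hκ]
  · rw [map_add, PowerSeries.coeff_succ_X_mul, PowerSeries.coeff_mk, PowerSeries.coeff_mk,
      PowerSeries.coeff_C, if_neg n.succ_ne_zero, zero_add]

theorem leading_sub_leading (α : ℚ) (k : Ser K) (g g' : PowerSeries K) :
    zpow K α * (k + zpow K (-1) * ofPow K g) - zpow K α * (k + zpow K (-1) * ofPow K g') =
      zpow K α * (zpow K (-1) * ofPow K (g - g')) := by
  rw [map_sub]
  ring

/-- The first summand is the leading coefficient produced by `solEntry` from the unit vector of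
index a; the second is the identity correction for a = m₁. -/
theorem KMat_apply (m₁ m₂ a : ℕ) (i j : Fin (m₁ + m₂)) :
    KMat m₁ m₂ a i j = HahnSeries.C ((((if i.val < j.val then 1 else 0) -
      (if m₁ ≤ j.val then 1 else 0) : ℤ) : Cs) *
        (if (i.val : ℤ) - j.val + m₁ = a then 1 else 0) + if a = m₁ ∧ i = j then 1 else 0) := by
  have hi := i.2
  have hj := j.2
  have hij : i = j ↔ i.val = j.val := Fin.ext_iff
  rw [KMat]
  simp only [hij]
  by_cases h : a ≤ m₁
  · rw [if_pos h, Matrix.sum_apply]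
    simp only [eUnit, Matrix.of_apply]
    by_cases h' : i.val < a ∧ j.val + a = i.val + m₁
    · rw [Finset.sum_eq_single_of_mem (i.val + 1) (Finset.mem_Icc.2 ⟨by omega, by omega⟩)
        fun k _ hk => if_neg fun h => hk h.1.symm, if_pos ⟨rfl, by omega⟩]
      split_ifs <;> first | omega | simp
    · rw [Finset.sum_eq_zero fun k hk => if_neg fun h'' => h' ?_]
      · split_ifs <;> first | omega | simp
      · have := Finset.mem_Icc.1 hk
        omega
  · rw [if_neg h, Matrix.neg_apply, Matrix.sum_apply]
    simp only [eUnit, Matrix.of_apply]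
    by_cases h' : m₁ ≤ j.val ∧ j.val + a = i.val + m₁
    · rw [Finset.sum_eq_single_of_mem (j.val + 1 - m₁) (Finset.mem_Icc.2 ⟨by omega, by omega⟩)
        fun k _ hk => if_neg fun h => hk (by omega), if_pos ⟨by omega, by omega⟩]
      split_ifs <;> first | omega | simp
    · rw [Finset.sum_eq_zero fun k hk => if_neg fun h'' => h' ?_]
      · split_ifs <;> first | omega | simp
      · have := Finset.mem_Icc.1 hk
        omega

theorem map_shift_one_add {l : ℕ} (M : Matrix (Fin l) (Fin l) (Ser K)) :
    (1 + M).map shift = 1 + M.map shift := by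
  ext i j : 1
  rw [Matrix.map_apply, Matrix.add_apply, Matrix.add_apply, Matrix.map_apply, shift_eq_shiftBy,
    shift_eq_shiftBy, shiftBy_add, Matrix.one_apply]
  split_ifs
  · rw [shiftBy_one]
  · rw [shiftBy_zero_right]

theorem map_shift_sub {l : ℕ} (M N : Matrix (Fin l) (Fin l) (Ser K)) :
    (M - N).map shift = M.map shift - N.map shift := by
  ext i j : 1
  simp only [Matrix.map_apply, Matrix.sub_apply, shift_eq_shiftBy, shiftBy_sub]

/-! ### Existence and uniqueness of the matrix solution -/

variable {m₁ m₂ a : ℕ}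

theorem exists_isSolution (hm₁ : 1 ≤ m₁) (hm₂ : 1 ≤ m₂) (ha₁ : 1 ≤ a) (ha₂ : a ≤ m₁ + m₂ - 1) :
    ∃ M : Matrix (Fin (m₁ + m₂)) (Fin (m₁ + m₂)) (Ser Cs), IsSolution m₁ m₂ a M ∧
      ∀ i j, M i j ∈ gradedSeries ratPolys (-(1 - q m₁ m₂ a)) := by
  obtain ⟨y, hy, hmem, hlead, hsys⟩ := exists_sysSol hm₁ hm₂ ha₁ ha₂ X_mem_ratPolys
  let N : Matrix (Fin (m₁ + m₂)) (Fin (m₁ + m₂)) (Ser Cs) :=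
    Matrix.of fun i j => solEntry m₁ m₂ y i j
  -- For a = m₁ the exponent 1 - q_a is 0 and `N` has leading term K_a minus the identity, so the
  -- constant solution 1 is added.
  let M : Matrix (Fin (m₁ + m₂)) (Fin (m₁ + m₂)) (Ser Cs) := if a = m₁ then 1 + N else N
  have hq : q m₁ m₂ a - 1 = -(1 - q m₁ m₂ a) := by ring
  have hN : N.map shift * W m₁ m₂ = W m₁ m₂ * N := by
    ext i j : 1
    rw [← sub_eq_zero, map_shift_mul_W_sub m₁ m₂ hm₁ hm₂ (solEntry m₁ m₂ y) N fun _ _ => rfl]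
    exact (tdeEntry_solEntry_eq_zero_iff hm₁ hm₂ hy).2 hsys _ _ i.2 j.2
  have hNmem (i j : Fin (m₁ + m₂)) : N i j ∈ gradedSeries ratPolys (-(1 - q m₁ m₂ a)) := by
    rw [← hq]
    exact solEntry_mem_gradedSeries X_mem_ratPolys hmem _ _
  have hq1 (h : a = m₁) : q m₁ m₂ a = 1 := by
    rw [q, if_pos h.le, h, div_self (by exact_mod_cast (by omega : m₁ ≠ 0))]
  have h1 : (1 : Ser Cs) ∈ gradedSeries ratPolys 0 := by
    rw [← map_one (ofPow Cs)]
    refine ofPow_mem_gradedSeries fun n => ?_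
    rw [PowerSeries.coeff_one]
    split_ifs
    · exact ratPolys.one_mem
    · exact ratPolys.zero_mem
  have hMmem (i j : Fin (m₁ + m₂)) : M i j ∈ gradedSeries ratPolys (-(1 - q m₁ m₂ a)) := by
    simp only [M]
    split_ifs with h
    · refine AddSubgroup.add_mem _ ?_ (hNmem i j)
      rw [hq1 h, sub_self, neg_zero, Matrix.one_apply]
      split_ifs
      · exact h1
      · exact AddSubgroup.zero_mem _
    · exact hNmem i j
  have hMlead (i j : Fin (m₁ + m₂)) : (M i j).coeff (-(1 - q m₁ m₂ a)) =
      (((if i.val < j.val then 1 else 0) - (if m₁ ≤ j.val then 1 else 0) : ℤ) : Cs) *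
        (if (i.val : ℤ) - j.val + m₁ = a then 1 else 0) + if a = m₁ ∧ i = j then 1 else 0 := by
    have hNc : (N i j).coeff (-(1 - q m₁ m₂ a)) = (((if i.val < j.val then 1 else 0) -
        (if m₁ ≤ j.val then 1 else 0) : ℤ) : Cs) *
        (if (i.val : ℤ) - j.val + m₁ = a then 1 else 0) := by
      rw [← hq, ← hlead]
      exact solEntry_coeff hmem _ _
    by_cases h : a = m₁
    · simp only [M]
      rw [if_pos h, Matrix.add_apply, HahnSeries.coeff_add, hNc, add_comm, hq1 h, Matrix.one_apply]
      congr 1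
      by_cases hij : i = j
      · simp [h, hij]
      · simp [hij]
    · simp only [M]
      rw [if_neg h, hNc, if_neg fun h' : a = m₁ ∧ i = j => h h'.1, add_zero]
  refine ⟨M, ⟨?_, ?_, ?_⟩, hMmem⟩
  · choose L hL using fun i j => exists_ofLaurent (hMmem i j)
    exact ⟨Matrix.of L, Matrix.ext fun i j => hL i j⟩
  · simp only [M]
    split_ifs
    · rw [map_shift_one_add, add_mul, mul_add, hN, one_mul, mul_one]
    · exact hN
  · choose R hR using fun i j => exists_leading (hMmem i j) (hMlead i j)
    refine ⟨Matrix.of R, Matrix.ext fun i j => (hR i j).trans ?_⟩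
    rw [← KMat_apply m₁ m₂ a]
    rfl

/-- The common leading term cancels in the difference, which gains one order: it lies in z^(-q_a)
times matrices of power series in z⁻¹, where `eq_zero_of_tdeEntry` applies with ρ = q_a. -/
theorem IsSolution.unique (hm₁ : 1 ≤ m₁) (hm₂ : 1 ≤ m₂) (ha₁ : 1 ≤ a) (ha₂ : a ≤ m₁ + m₂ - 1)
    {M M' : Matrix (Fin (m₁ + m₂)) (Fin (m₁ + m₂)) (Ser Cs)} (hM : IsSolution m₁ m₂ a M)
    (hM' : IsSolution m₁ m₂ a M') : M = M' := by
  obtain ⟨R, hR⟩ := hM.leading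
  obtain ⟨R', hR'⟩ := hM'.leading
  have entry {M : Matrix (Fin (m₁ + m₂)) (Fin (m₁ + m₂)) (Ser Cs)}
      {R : Matrix (Fin (m₁ + m₂)) (Fin (m₁ + m₂)) (PowerSeries Cs)}
      (h : M = zpow Cs (1 - q m₁ m₂ a) • (KMat m₁ m₂ a + zpow Cs (-1) • R.map (ofPow Cs)))
      (i j : Fin (m₁ + m₂)) : M i j = zpow Cs (1 - q m₁ m₂ a) *
        (KMat m₁ m₂ a i j + zpow Cs (-1) * ofPow Cs (R i j)) := by
    rw [h, Matrix.smul_apply, Matrix.add_apply, Matrix.smul_apply, Matrix.map_apply, smul_eq_mul,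
      smul_eq_mul]
  have hD (i j : Fin (m₁ + m₂)) : (M - M') i j ∈ gradedSeries ⊤ (q m₁ m₂ a) := by
    have h : (M - M') i j = zpow Cs (1 - q m₁ m₂ a) * (zpow Cs (-1) *
        ofPow Cs (R i j - R' i j)) := by
      rw [Matrix.sub_apply, entry hR, entry hR', leading_sub_leading]
    have hmem := zpow_mul_mem_gradedSeries (1 - q m₁ m₂ a) (zpow_mul_mem_gradedSeries (-1)
      (ofPow_mem_gradedSeries (P := ⊤) (F := R i j - R' i j) fun _ => Algebra.mem_top))
    rwa [← h, show 0 - (-1) - (1 - q m₁ m₂ a) = q m₁ m₂ a by ring] at hmem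
  let F : ℕ → ℕ → Ser Cs := fun i j =>
    if h : i < m₁ + m₂ ∧ j < m₁ + m₂ then (M - M') ⟨i, h.1⟩ ⟨j, h.2⟩ else 0
  have hF (i j : Fin (m₁ + m₂)) : (M - M') i j = F i j := by simp [F]
  have htde : (M - M').map shift * W m₁ m₂ = W m₁ m₂ * (M - M') := by
    rw [map_shift_sub, sub_mul, mul_sub, hM.tde, hM'.tde]
  rw [← sub_eq_zero]
  ext i j : 1
  rw [hF]
  refine eq_zero_of_tdeEntry hm₁ hm₂ (q_pos hm₁ hm₂ ha₁ ha₂) (fun i j hi hj => ?_)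
    (fun i j hi hj => ?_) i.2 j.2
  · exact hF ⟨i, hi⟩ ⟨j, hj⟩ ▸ hD ⟨i, hi⟩ ⟨j, hj⟩
  · rw [← map_shift_mul_W_sub m₁ m₂ hm₁ hm₂ F (M - M') hF ⟨i, hi⟩ ⟨j, hj⟩, htde, sub_self]

end Main

end TDE

end
theorem mainTheorem8 (m₁ m₂ : ℕ) (hm₁ : 1 ≤ m₁) (hm₂ : 1 ≤ m₂)
    (a : ℕ) (ha₁ : 1 ≤ a) (ha₂ : a ≤ m₁ + m₂ - 1) :
    (∃! M : Matrix (Fin (m₁ + m₂)) (Fin (m₁ + m₂)) (TDE.Ser TDE.Cs),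
      TDE.IsSolution m₁ m₂ a M) ∧
    ∀ M : Matrix (Fin (m₁ + m₂)) (Fin (m₁ + m₂)) (TDE.Ser TDE.Cs),
      TDE.IsSolution m₁ m₂ a M →
        ∃ P : Matrix (Fin (m₁ + m₂)) (Fin (m₁ + m₂)) (PowerSeries (Polynomial ℚ)),
          M = TDE.zpow TDE.Cs (1 - TDE.q m₁ m₂ a) • P.map TDE.ofRatPow := by
  obtain ⟨M, hM, hmem⟩ := TDE.exists_isSolution hm₁ hm₂ ha₁ ha₂
  refine ⟨⟨M, hM, fun M' hM' => hM'.unique hm₁ hm₂ ha₁ ha₂ hM⟩, fun M' hM' => ?_⟩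
  obtain rfl := hM'.unique hm₁ hm₂ ha₁ ha₂ hM
  choose P hP using fun i j => TDE.exists_ofRatPow (hmem i j)
  exact ⟨Matrix.of P, Matrix.ext fun i j => hP i j⟩
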